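/- Let $k$ be a commutative ring. All groups are finite. For groups $G,H$ let $B(H,G)$ be the Grothendieck group of finite $(H,G)$-bisets with respect to disjoint union, and $kB(H,G)=k\otimes_{\mathbb Z}B(H,G)$. The biset category $\mathcal C$ has all finite groups as objects, $\mathcal C(G,H)=B(H,G)$, and composition induced by $Y\circ X=Y\times_H X$. Let $\mathcal D$ be a full subcategory of $\mathcal C$ with at least one object, such that every group isomorphic to a subquotient of an object of $\mathcal D$ or to a product of two objects of $\mathcal D$ is an object of $\mathcal D$; let $k\mathcal D$ be its $k$-linearization. For a group homomorphism $\psi:H\to G$ let ${}_{H^\psi}G_G$ be the $(H,G)$-biset $G$ with $h\cdot x\cdot g=\psi(h)xg$. For an isomorphism $\psi:H\to G$ let $\mathrm{Iso}(\psi)$ be the $(G,H)$-biset $G$ with $g\cdot x\cdot h=gx\psi(h)$. A Green biset functor is a $k$-linear functor $A:k\mathcal D\to k\text{-Mod}$ together with $k$-bilinear products $A(K)\times A(H)\to A(K\times H)$, $(a,b)\mapsto a\times b$, and an element $\epsilon_A\in A(1)$, such that for all objects and elements: $(a\times b)\times c=A(\mathrm{Iso}(\alpha))(a\times(b\times c))$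 for the canonical isomorphism $\alpha:L\times(K\times H)\to(L\times K)\times H$; $A(\mathrm{Iso}(\lambda_H))(\epsilon_A\times a)=a=A(\mathrm{Iso}(\rho_H))(a\times\epsilon_A)$ for the canonical isomorphisms $\lambda_H:1\times H\to H$ and $\rho_H:H\times 1\to H$; and $A(\alpha\times\beta)(a\times b)=A(\alpha)(a)\times A(\beta)(b)$ for all morphisms $\alpha,\beta$ of $k\mathcal D$, where $\alpha\times\beta$ is induced by the external product of bisets. The associated category $\mathcal P_A$ has the objects of $\mathcal D$, with $\mathcal P_A(H,K)=A(K\times H)$ and $\beta\circ\alpha=A(L\times\overleftarrow{K}\times H)(\beta\times\alpha)$ for $\beta\in A(L\times K)$, $\alpha\in A(K\times H)$, where $\overleftarrow{K}$ is the $(1,K\times K)$-biset $K$ with $x\cdot(k_1,k_2)=k_1^{-1}xk_2$. The essential algebra of $A$ at $H$ is $\widehat A(H)=A(H\times H)/I_A(H)$, where $I_A(H)$ is the $k$-submodule generated by the endomorphisms of $H$ in $\mathcal P_A$ that factor through an object of order smaller than $|H|$. The essential support of $A$ is the class of objects $H$ of $\mathcal D$ with $\widehat A(H)\neq 0$. For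 an object $G$ of $\mathcal D$, the shifted functor $A_G$ is the Green biset functor with $A_G(H)=A(H\times G)$, $A_G(\alpha)=A(\alpha\times\mathrm{Id}_G)$, product $a\times^d b=A({}_{(K\times H\times G)^{\delta}}(K\times G\times H\times G))(a\times b)$ for $a\in A(K\times G)$, $b\in A(H\times G)$, where $\delta(k,h,g)=(k,g,h,g)$, and identity element $A(\mathrm{Inf}_1^{1\times G})(\epsilon_A)\in A(1\times G)$, where $\mathrm{Inf}_1^{1\times G}$ is the biset of the homomorphism $1\times G\to 1$. **Corollary.** For every such $k$ and $\mathcal D$, every Green biset functor $A$ for $\mathcal D$ over $k$, and every object $G$ of $\mathcal D$, the essential support of $A_G$ equals the essential support of $A$. -/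

import Mathlib

open CategoryTheory TensorProduct

universe u v w

/-- An `(H, G)`-biset: a finite set with a left action of `H` and a right action of `G`
that commute with each other. -/
structure Biset (H G : Type u) [Group H] [Group G] : Type (u + 1) where
  carrier : Type u
  finite : Finite carrier
  left : H → carrier → carrier
  right : carrier → G → carrier
  one_left : ∀ x, left 1 x = x
  mul_left : ∀ h h' x, left (h * h') x = left h (left h' x)
  right_one : ∀ x, right x 1 = x
  right_mul : ∀ x g g', right x (g * g') = right (right x g) g'
  left_right : ∀ h x g, left h (right x g) = right (left h x) g

namespace Biset

attribute [simp] one_left right_one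

section

variable {L K H G H' G' K' : Type u} [Group L] [Group K] [Group H] [Group G] [Group H'] [Group G']
  [Group K']

/-- An isomorphism of bisets: a bijection that respects both actions. -/
structure Iso (X Y : Biset H G) where
  toEquiv : X.carrier ≃ Y.carrier
  map_left : ∀ h x, toEquiv (X.left h x) = Y.left h (toEquiv x)
  map_right : ∀ x g, toEquiv (X.right x g) = Y.right (toEquiv x) g

/-- The identity isomorphism. -/
def Iso.refl (X : Biset H G) : Iso X X := ⟨Equiv.refl _, fun _ _ => rfl, fun _ _ => rfl⟩

/-- The inverse isomorphism. -/
def Iso.symm {X Y : Biset H G} (e : Iso X Y) : Iso Y X where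
  toEquiv := e.toEquiv.symm
  map_left h x := by rw [Equiv.symm_apply_eq, e.map_left, Equiv.apply_symm_apply]
  map_right x g := by rw [Equiv.symm_apply_eq, e.map_right, Equiv.apply_symm_apply]

/-- The composite of two isomorphisms. -/
def Iso.trans {X Y Z : Biset H G} (e : Iso X Y) (f : Iso Y Z) : Iso X Z where
  toEquiv := e.toEquiv.trans f.toEquiv
  map_left h x := by simp [e.map_left, f.map_left]
  map_right x g := by simp [e.map_right, f.map_right]

/-- The isomorphism relation on `(H, G)`-bisets. -/
instance setoid (H G : Type u) [Group H] [Group G] : Setoid (Biset H G) where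
  r X Y := Nonempty (Iso X Y)
  iseqv := ⟨fun X => ⟨Iso.refl X⟩, fun ⟨e⟩ => ⟨e.symm⟩, fun ⟨e⟩ ⟨f⟩ => ⟨e.trans f⟩⟩

/-- The empty biset. -/
def empty (H G : Type u) [Group H] [Group G] : Biset H G where
  carrier := PEmpty
  finite := inferInstance
  left _ x := x
  right x _ := x
  one_left _ := rfl
  mul_left _ _ _ := rfl
  right_one _ := rfl
  right_mul _ _ _ := rfl
  left_right _ _ _ := rfl

/-- The disjoint union of two bisets. -/
def disjUnion (X Y : Biset H G) : Biset H G where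
  carrier := X.carrier ⊕ Y.carrier
  finite := by
    have := X.finite
    have := Y.finite
    infer_instance
  left h := Sum.map (X.left h) (Y.left h)
  right x g := Sum.map (fun a => X.right a g) (fun b => Y.right b g) x
  one_left := by rintro (x | x) <;> simp
  mul_left := by rintro h h' (x | x) <;> simp [mul_left]
  right_one := by rintro (x | x) <;> simp
  right_mul := by rintro (x | x) g g' <;> simp [right_mul]
  left_right := by rintro h (x | x) g <;> simp [left_right]

/-- Disjoint unions of isomorphic bisets are isomorphic. -/
def disjUnionCongr {X X' Y Y' : Biset H G} (e : Iso X X') (f : Iso Y Y') :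
    Iso (X.disjUnion Y) (X'.disjUnion Y') where
  toEquiv := Equiv.sumCongr e.toEquiv f.toEquiv
  map_left := by
    rintro h (x | x)
    · exact congrArg Sum.inl (e.map_left h x)
    · exact congrArg Sum.inr (f.map_left h x)
  map_right := by
    rintro (x | x) g
    · exact congrArg Sum.inl (e.map_right x g)
    · exact congrArg Sum.inr (f.map_right x g)

/-- The biset obtained from a group homomorphism `ψ : H → G`: the set `G` with the actions
`h · x · g = ψ(h) x g`. -/
def ofHom [Finite G] (ψ : H →* G) : Biset H G where
  carrier := G
  finite := inferInstance
  left h x := ψ h * x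
  right x g := x * g
  one_left x := by simp
  mul_left h h' x := by simp [mul_assoc]
  right_one := mul_one
  right_mul x g g' := by simp [mul_assoc]
  left_right h x g := by simp [mul_assoc]

/-- The identity `(G, G)`-biset: the set `G` with left and right multiplication. -/
def id (G : Type u) [Group G] [Finite G] : Biset G G := ofHom (MonoidHom.id G)

/-- The opposite biset, with `g · x · h = h⁻¹ x g⁻¹`. -/
def op (X : Biset H G) : Biset G H where
  carrier := X.carrier
  finite := X.finite
  left g x := X.right x g⁻¹
  right x h := X.left h⁻¹ x
  one_left x := by simp
  mul_left g g' x := by simp [X.right_mul]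
  right_one x := by simp
  right_mul x h h' := by simp [X.mul_left]
  left_right g x h := by simp [X.left_right]

/-- The biset `Iso(ψ)` of a group isomorphism `ψ : H → G`: the set `G` with the actions
`g · x · h = g x ψ(h)`. -/
def ofIso [Finite G] (ψ : H ≃* G) : Biset G H where
  carrier := G
  finite := inferInstance
  left g x := g * x
  right x h := x * ψ h
  one_left x := by simp
  mul_left g g' x := by simp [mul_assoc]
  right_one := by simp
  right_mul x h h' := by simp [mul_assoc]
  left_right g x h := by simp [mul_assoc]

/-- The external product of an `(L, K)`-biset and an `(H, G)`-biset. -/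
def prod (Y : Biset L K) (X : Biset H G) : Biset (L × H) (K × G) where
  carrier := Y.carrier × X.carrier
  finite := by
    have := X.finite
    have := Y.finite
    infer_instance
  left a z := (Y.left a.1 z.1, X.left a.2 z.2)
  right z b := (Y.right z.1 b.1, X.right z.2 b.2)
  one_left z := by simp
  mul_left a a' z := by simp [mul_left]
  right_one z := by simp
  right_mul z b b' := by simp [right_mul]
  left_right a z b := by simp [left_right]

/-- The relation on `Y × X` of lying in the same orbit of `H`, which acts by
`h · (y, x) = (y h⁻¹, h x)`. -/
def compSetoid (Y : Biset K H) (X : Biset H G) : Setoid (Y.carrier × X.carrier) where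
  r p q := ∃ h : H, q = (Y.right p.1 h⁻¹, X.left h p.2)
  iseqv :=
    { refl := fun p => ⟨1, by simp⟩
      symm := by
        rintro p q ⟨h, rfl⟩
        exact ⟨h⁻¹, by simp [← Y.right_mul, ← X.mul_left]⟩
      trans := by
        rintro p q r ⟨h, rfl⟩ ⟨h', rfl⟩
        exact ⟨h' * h, by simp [← Y.right_mul, ← X.mul_left]⟩ }

/-- The underlying set of the composite `Y ×_H X`. -/
def CompCarrier (Y : Biset K H) (X : Biset H G) : Type u := Quotient (compSetoid Y X)

/-- The orbit `[y, x]` in `Y ×_H X`. -/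
def compMk (Y : Biset K H) (X : Biset H G) (y : Y.carrier) (x : X.carrier) : CompCarrier Y X :=
  Quotient.mk (compSetoid Y X) (y, x)

theorem compMk_balanced (Y : Biset K H) (X : Biset H G) (y : Y.carrier) (h : H) (x : X.carrier) :
    compMk Y X (Y.right y h) x = compMk Y X y (X.left h x) :=
  Quotient.sound ⟨h, by simp [← Y.right_mul]⟩

/-- A function on `Y × X` with `f (y h) x = f y (h x)` descends to `Y ×_H X`. -/
def compLift {Y : Biset K H} {X : Biset H G} {α : Sort*} (f : Y.carrier → X.carrier → α)
    (hf : ∀ y h x, f (Y.right y h) x = f y (X.left h x)) (z : CompCarrier Y X) : α :=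
  Quotient.lift (fun p : Y.carrier × X.carrier => f p.1 p.2)
    (by
      rintro ⟨y, x⟩ q ⟨h, rfl⟩
      simp [hf, ← X.mul_left]) z

@[simp]
theorem compLift_mk {Y : Biset K H} {X : Biset H G} {α : Sort*} (f : Y.carrier → X.carrier → α)
    (hf : ∀ y h x, f (Y.right y h) x = f y (X.left h x)) (y : Y.carrier) (x : X.carrier) :
    compLift f hf (compMk Y X y x) = f y x := rfl

theorem comp_ind {Y : Biset K H} {X : Biset H G} {p : CompCarrier Y X → Prop}
    (h : ∀ y x, p (compMk Y X y x)) (z : CompCarrier Y X) : p z :=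
  Quotient.ind (fun q => h q.1 q.2) z

/-- The composite `Y ×_H X` with the actions `k · [y, x] · g = [k y, x g]`. -/
def comp (Y : Biset K H) (X : Biset H G) : Biset K G where
  carrier := CompCarrier Y X
  finite := by
    have := X.finite
    have := Y.finite
    exact Quotient.finite _
  left k := compLift (fun y x => compMk Y X (Y.left k y) x)
    (fun y h x => by rw [Y.left_right, compMk_balanced])
  right z g := compLift (fun y x => compMk Y X y (X.right x g))
    (fun y h x => by rw [← X.left_right, compMk_balanced]) z
  one_left := comp_ind fun y x => by simp
  mul_left k k' := comp_ind fun y x => by simp [Y.mul_left]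
  right_one := comp_ind fun y x => by simp
  right_mul z g g' := by
    revert z
    exact comp_ind fun y x => by simp [X.right_mul]
  left_right k z g := by
    revert z
    exact comp_ind fun y x => by simp

@[simp]
theorem comp_left_mk (Y : Biset K H) (X : Biset H G) (k : K) (y : Y.carrier) (x : X.carrier) :
    (comp Y X).left k (compMk Y X y x) = compMk Y X (Y.left k y) x := rfl

@[simp]
theorem comp_right_mk (Y : Biset K H) (X : Biset H G) (g : G) (y : Y.carrier) (x : X.carrier) :
    (comp Y X).right (compMk Y X y x) g = compMk Y X y (X.right x g) := rfl

/-- The biset `→H`: the set `H` with the left action `(h₁, h₂) · x = h₁ x h₂⁻¹` of `H × H` and the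
action of the trivial group on the right. -/
def diag (H : Type u) [Group H] [Finite H] : Biset (H × H) PUnit.{u + 1} where
  carrier := H
  finite := inferInstance
  left a x := a.1 * x * a.2⁻¹
  right x _ := x
  one_left x := by simp
  mul_left a a' x := by simp [mul_assoc]
  right_one _ := rfl
  right_mul _ _ _ := rfl
  left_right _ _ _ := rfl

/-- The biset `L × ←K × H`, the external product of `L`, the opposite of `→K`, and `H`, as an
`(L × H, (L × K) × (K × H))`-biset: the trivial factor on the left is dropped and the four factors
on the right are bracketed in pairs. -/
def contract (L K H : Type u) [Group L] [Group K] [Group H] [Finite L] [Finite K] [Finite H] :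
    Biset (L × H) ((L × K) × (K × H)) where
  carrier := L × (diag K).op.carrier × H
  finite := by
    have := (diag K).op.finite
    infer_instance
  left a z := (a.1 * z.1, z.2.1, a.2 * z.2.2)
  right z b := (z.1 * b.1.1, (diag K).op.right z.2.1 (b.1.2, b.2.1), z.2.2 * b.2.2)
  one_left z := by simp
  mul_left a a' z := by simp [mul_assoc]
  right_one z := by
    have h := (diag K).op.right_one z.2.1
    exact Prod.ext (mul_one _) (Prod.ext h (mul_one _))
  right_mul z b b' := by
    have h := (diag K).op.right_mul z.2.1 (b.1.2, b.2.1) (b'.1.2, b'.2.1)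
    exact Prod.ext (mul_assoc _ _ _).symm (Prod.ext h (mul_assoc _ _ _).symm)
  left_right a z b := by simp [mul_assoc]

/-- The diagonal homomorphism `K × H × G → K × G × H × G`, `(k, h, g) ↦ (k, g, h, g)`. -/
def shiftDiag (K H G : Type u) [Group K] [Group H] [Group G] :
    (K × H) × G →* (K × G) × (H × G) where
  toFun a := ((a.1.1, a.2), (a.1.2, a.2))
  map_one' := rfl
  map_mul' _ _ := rfl

/-- The biset `K × G × H × G` for the group `K × H × G`, acting on the left through the
diagonal of `G`, and the group `K × G × H × G`, acting on the right. -/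
def shiftBiset (K H G : Type u) [Group K] [Group H] [Group G] [Finite K] [Finite H] [Finite G] :
    Biset ((K × H) × G) ((K × G) × (H × G)) :=
  ofHom (shiftDiag K H G)

/-! ### Isomorphisms between composites and external products of bisets -/

/-- Isomorphic bisets have isomorphic composites. -/
def compCongr {Y Y' : Biset K H} {X X' : Biset H G} (e : Iso Y Y') (f : Iso X X') :
    Iso (Y.comp X) (Y'.comp X') where
  toEquiv :=
    { toFun := compLift (fun y x => compMk Y' X' (e.toEquiv y) (f.toEquiv x))
        (fun y h x => by rw [e.map_right, f.map_left, compMk_balanced])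
      invFun := compLift (fun y x => compMk Y X (e.symm.toEquiv y) (f.symm.toEquiv x))
        (fun y h x => by rw [e.symm.map_right, f.symm.map_left, compMk_balanced])
      left_inv := comp_ind fun y x => congrArg₂ (compMk Y X)
        (e.toEquiv.symm_apply_apply y) (f.toEquiv.symm_apply_apply x)
      right_inv := comp_ind fun y x => congrArg₂ (compMk Y' X')
        (e.toEquiv.apply_symm_apply y) (f.toEquiv.apply_symm_apply x) }
  map_left k := comp_ind fun y x => by
    change compMk _ _ _ _ = compMk _ _ _ _
    rw [e.map_left]
  map_right z g := by
    revert z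
    refine comp_ind fun y x => ?_
    change compMk _ _ _ _ = compMk _ _ _ _
    rw [f.map_right]

/-- Isomorphic bisets have isomorphic external products. -/
def prodCongr {Y Y' : Biset L K} {X X' : Biset H G} (e : Iso Y Y') (f : Iso X X') :
    Iso (Y.prod X) (Y'.prod X') where
  toEquiv := Equiv.prodCongr e.toEquiv f.toEquiv
  map_left _ _ := Prod.ext (e.map_left _ _) (f.map_left _ _)
  map_right _ _ := Prod.ext (e.map_right _ _) (f.map_right _ _)

/-- Composition distributes over disjoint unions on the left. -/
def disjUnionComp (Y Y' : Biset K H) (X : Biset H G) :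
    Iso ((Y.disjUnion Y').comp X) ((Y.comp X).disjUnion (Y'.comp X)) where
  toEquiv :=
    { toFun := compLift
        (fun y x => Sum.map (fun a => compMk Y X a x) (fun b => compMk Y' X b x) y)
        (by
          rintro (y | y) h x
          · exact congrArg Sum.inl (compMk_balanced Y X y h x)
          · exact congrArg Sum.inr (compMk_balanced Y' X y h x))
      invFun := Sum.elim
        (compLift (fun y x => compMk (Y.disjUnion Y') X (Sum.inl y) x)
          (fun y h x => compMk_balanced (Y.disjUnion Y') X (Sum.inl y) h x))
        (compLift (fun y x => compMk (Y.disjUnion Y') X (Sum.inr y) x)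
          (fun y h x => compMk_balanced (Y.disjUnion Y') X (Sum.inr y) h x))
      left_inv := comp_ind (by rintro (y | y) x <;> rfl)
      right_inv := by
        rintro (z | z)
        · revert z
          exact comp_ind fun _ _ => rfl
        · revert z
          exact comp_ind fun _ _ => rfl }
  map_left k := comp_ind (by rintro (y | y) x <;> rfl)
  map_right z g := by
    revert z
    exact comp_ind (by rintro (y | y) x <;> rfl)

/-- Composition distributes over disjoint unions on the right. -/
def compDisjUnion (Y : Biset K H) (X X' : Biset H G) :
    Iso (Y.comp (X.disjUnion X')) ((Y.comp X).disjUnion (Y.comp X')) where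
  toEquiv :=
    { toFun := compLift
        (fun y x => Sum.map (fun a => compMk Y X y a) (fun b => compMk Y X' y b) x)
        (by
          rintro y h (x | x)
          · exact congrArg Sum.inl (compMk_balanced Y X y h x)
          · exact congrArg Sum.inr (compMk_balanced Y X' y h x))
      invFun := Sum.elim
        (compLift (fun y x => compMk Y (X.disjUnion X') y (Sum.inl x))
          (fun y h x => compMk_balanced Y (X.disjUnion X') y h (Sum.inl x)))
        (compLift (fun y x => compMk Y (X.disjUnion X') y (Sum.inr x))
          (fun y h x => compMk_balanced Y (X.disjUnion X') y h (Sum.inr x)))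
      left_inv := comp_ind (by rintro y (x | x) <;> rfl)
      right_inv := by
        rintro (z | z)
        · revert z
          exact comp_ind fun _ _ => rfl
        · revert z
          exact comp_ind fun _ _ => rfl }
  map_left k := comp_ind (by rintro y (x | x) <;> rfl)
  map_right z g := by
    revert z
    exact comp_ind (by rintro y (x | x) <;> rfl)

/-- External products distribute over disjoint unions on the left. -/
def disjUnionProd (Y Y' : Biset L K) (X : Biset H G) :
    Iso ((Y.disjUnion Y').prod X) ((Y.prod X).disjUnion (Y'.prod X)) where
  toEquiv := Equiv.sumProdDistrib _ _ _
  map_left := by rintro a ⟨y | y, x⟩ <;> rfl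
  map_right := by rintro ⟨y | y, x⟩ b <;> rfl

/-- External products distribute over disjoint unions on the right. -/
def prodDisjUnion (Y : Biset L K) (X X' : Biset H G) :
    Iso (Y.prod (X.disjUnion X')) ((Y.prod X).disjUnion (Y.prod X')) where
  toEquiv := Equiv.prodSumDistrib _ _ _
  map_left := by rintro a ⟨y, x | x⟩ <;> rfl
  map_right := by rintro ⟨y, x | x⟩ b <;> rfl

/-- Composition is associative up to isomorphism. -/
def compAssoc (Z : Biset L K) (Y : Biset K H) (X : Biset H G) :
    Iso ((Z.comp Y).comp X) (Z.comp (Y.comp X)) where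
  toEquiv :=
    { toFun := compLift
        (fun w x => compLift (fun z y => compMk Z (Y.comp X) z (compMk Y X y x))
          (fun z k y => compMk_balanced Z (Y.comp X) z k (compMk Y X y x)) w)
        (fun w h x => by
          revert w
          exact comp_ind fun z y => congrArg (compMk Z (Y.comp X) z) (compMk_balanced Y X y h x))
      invFun := compLift
        (fun z w => compLift (fun y x => compMk (Z.comp Y) X (compMk Z Y z y) x)
          (fun y h x => compMk_balanced (Z.comp Y) X (compMk Z Y z y) h x) w)
        (fun z k w => by
          revert w
          exact comp_ind fun y x =>
            congrArg (fun t => compMk (Z.comp Y) X t x) (compMk_balanced Z Y z k y))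
      left_inv := comp_ind fun w x => by
        revert w
        exact comp_ind fun z y => rfl
      right_inv := comp_ind fun z w => by
        revert w
        exact comp_ind fun y x => rfl }
  map_left l := comp_ind fun w x => by
    revert w
    exact comp_ind fun z y => rfl
  map_right v g := by
    revert v
    refine comp_ind fun w x => ?_
    revert w
    exact comp_ind fun z y => rfl

/-- Composing with the biset of a homomorphism restricts the left action along it. -/
def ofHomComp [Finite H] (φ : K →* H) (X : Biset H G) :
    Iso ((ofHom φ).comp X)
      { carrier := X.carrier
        finite := X.finite
        left := fun k x => X.left (φ k) x
        right := X.right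
        one_left := fun x => by simp
        mul_left := fun k k' x => by simp [X.mul_left]
        right_one := X.right_one
        right_mul := X.right_mul
        left_right := fun k x g => X.left_right (φ k) x g } where
  toEquiv :=
    { toFun := compLift (fun h x => X.left h x) (fun y h x => X.mul_left y h x)
      invFun := fun x => compMk (ofHom φ) X (1 : H) x
      left_inv := comp_ind fun h x => (compMk_balanced (ofHom φ) X (1 : H) h x).symm.trans
        (congrArg (fun a => compMk (ofHom φ) X a x) (one_mul (M := H) h))
      right_inv := fun x => X.one_left x }
  map_left k := comp_ind fun h x => X.mul_left _ _ _
  map_right z g := by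
    revert z
    exact comp_ind fun h x => X.left_right _ _ _

/-- The identity biset is a left identity. -/
def idComp [Finite H] (X : Biset H G) : Iso ((id H).comp X) X := ofHomComp (MonoidHom.id H) X

/-- The identity biset is a right identity. -/
def compId [Finite G] (X : Biset H G) : Iso (X.comp (id G)) X where
  toEquiv :=
    { toFun := compLift (fun x g => X.right x g) (fun x g g' => (X.right_mul x g g').symm)
      invFun := fun x => compMk X (id G) x (1 : G)
      left_inv := comp_ind fun x g => (compMk_balanced X (id G) x g (1 : G)).trans
        (congrArg (fun a => compMk X (id G) x a) (mul_one (M := G) g))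
      right_inv := fun x => X.right_one x }
  map_left k := comp_ind fun x g => (X.left_right _ _ _).symm
  map_right z g := by
    revert z
    exact comp_ind fun x g => X.right_mul _ _ _

/-- Restrictions compose. -/
def ofHomCompOfHom [Finite H] [Finite G] (φ : K →* H) (ψ : H →* G) :
    Iso ((ofHom φ).comp (ofHom ψ)) (ofHom (ψ.comp φ)) := ofHomComp φ (ofHom ψ)

/-- The biset of a group isomorphism is the restriction along the inverse isomorphism. -/
def ofIsoIso [Finite G] [Finite H] (ψ : H ≃* G) :
    Iso (ofIso ψ) (ofHom (ψ.symm : G →* H)) where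
  toEquiv := ψ.symm.toEquiv
  map_left g x := map_mul ψ.symm g x
  map_right (x : G) h := (map_mul ψ.symm x (ψ h)).trans
    (congrArg (fun t => ψ.symm x * t) (ψ.symm_apply_apply h))

/-- The external product of two restrictions is a restriction. -/
def ofHomProdOfHom [Finite K] [Finite G] (φ : L →* K) (ψ : H →* G) :
    Iso ((ofHom φ).prod (ofHom ψ)) (ofHom (φ.prodMap ψ)) where
  toEquiv := Equiv.refl _
  map_left _ _ := rfl
  map_right _ _ := rfl

/-- External products commute with composition. -/
def prodCompProd (Y : Biset K H) (X : Biset H G) (Y' : Biset K' H') (X' : Biset H' G') :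
    Iso ((Y.prod Y').comp (X.prod X')) ((Y.comp X).prod (Y'.comp X')) where
  toEquiv :=
    { toFun := compLift (fun y x => (compMk Y X y.1 x.1, compMk Y' X' y.2 x.2))
        (fun y h x => Prod.ext (compMk_balanced _ _ _ _ _) (compMk_balanced _ _ _ _ _))
      invFun := fun z => compLift
        (fun y x => compLift
          (fun y' x' => compMk (Y.prod Y') (X.prod X') (y, y') (x, x'))
          (fun y' h' x' =>
            ((congrArg (fun t => compMk (Y.prod Y') (X.prod X') (t, Y'.right y' h') (x, x'))
              (Y.right_one y)).symm.trans
              (compMk_balanced (Y.prod Y') (X.prod X') (y, y') (1, h') (x, x'))).trans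
              (congrArg (fun t => compMk (Y.prod Y') (X.prod X') (y, y') (t, X'.left h' x'))
                (X.one_left x))) z.2)
        (fun y h x => by
          generalize z.2 = t
          revert t
          exact comp_ind fun y' x' =>
            ((congrArg (fun t => compMk (Y.prod Y') (X.prod X') (Y.right y h, t) (x, x'))
              (Y'.right_one y')).symm.trans
              (compMk_balanced (Y.prod Y') (X.prod X') (y, y') (h, 1) (x, x'))).trans
              (congrArg (fun t => compMk (Y.prod Y') (X.prod X') (y, y') (X.left h x, t))
                (X'.one_left x'))) z.1
      left_inv := comp_ind fun y x => rfl
      right_inv := by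
        rintro ⟨z, t⟩
        revert z t
        refine comp_ind fun y x => comp_ind fun y' x' => rfl }
  map_left k := comp_ind fun y x => rfl
  map_right z g := by
    revert z
    exact comp_ind fun y x => rfl

/-- The biset `K × G × H × G` is natural in `K` and `H`. -/
def shiftNat [Finite K] [Finite H] [Finite L] [Finite K'] [Finite G] (X : Biset L K)
    (Y : Biset K' H) :
    Iso (((X.prod Y).prod (id G)).comp (shiftBiset K H G))
      ((shiftBiset L K' G).comp ((X.prod (id G)).prod (Y.prod (id G)))) :=
  Iso.trans
    { toEquiv :=
        { toFun := compLift
            (fun (a : (X.carrier × Y.carrier) × G) (b : (K × G) × (H × G)) =>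
              (((X.right a.1.1 b.1.1, a.2 * b.1.2), (Y.right a.1.2 b.2.1, a.2 * b.2.2)) :
                (X.carrier × G) × (Y.carrier × G)))
            (fun y h x => Prod.ext
              (Prod.ext (X.right_mul _ _ _).symm (mul_assoc (G := G) _ _ _))
              (Prod.ext (Y.right_mul _ _ _).symm (mul_assoc (G := G) _ _ _)))
          invFun := fun (c : (X.carrier × G) × (Y.carrier × G)) =>
            compMk ((X.prod Y).prod (id G)) (shiftBiset K H G)
              ((c.1.1, c.2.1), (1 : G)) ((1, c.1.2), (1, c.2.2))
          left_inv := comp_ind (by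
            rintro ⟨⟨x, y⟩, (g : G)⟩ ⟨⟨k, g₁⟩, ⟨h, g₂⟩⟩
            have e₁ := compMk_balanced ((X.prod Y).prod (id G)) (shiftBiset K H G)
              ((x, y), (1 : G)) ((k, h), 1) ((1, g * g₁), (1, g * g₂))
            have e₂ := compMk_balanced ((X.prod Y).prod (id G)) (shiftBiset K H G)
              ((x, y), (1 : G)) ((1, 1), g) ((k, g₁), (h, g₂))
            refine Eq.trans ?_ (e₁.trans (Eq.trans ?_ (e₂.symm.trans ?_)))
            · exact congrArg₂ (compMk ((X.prod Y).prod (id G)) (shiftBiset K H G))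
                (Prod.ext rfl (mul_one (1 : G)).symm) rfl
            · exact congrArg (compMk ((X.prod Y).prod (id G)) (shiftBiset K H G)
                ((x, y), (1 : G))) (Prod.ext
                  (Prod.ext ((mul_one k).trans (one_mul k).symm) (one_mul (g * g₁)))
                  (Prod.ext ((mul_one h).trans (one_mul h).symm) (one_mul (g * g₂))))
            · exact congrArg (fun t => compMk ((X.prod Y).prod (id G)) (shiftBiset K H G) t
                ((k, g₁), (h, g₂))) (Prod.ext (Prod.ext (X.right_one x) (Y.right_one y))
                  (one_mul g)))
          right_inv := fun _ => Prod.ext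
            (Prod.ext (X.right_one _) (one_mul (M := G) _))
            (Prod.ext (Y.right_one _) (one_mul (M := G) _)) }
      map_left := fun a => comp_ind fun y x => Prod.ext
        (Prod.ext (X.left_right _ _ _).symm (mul_assoc (G := G) _ _ _))
        (Prod.ext (Y.left_right _ _ _).symm (mul_assoc (G := G) _ _ _))
      map_right := fun z b => by
        revert z
        exact comp_ind fun y x => Prod.ext
          (Prod.ext (X.right_mul _ _ _) (mul_assoc (G := G) _ _ _).symm)
          (Prod.ext (Y.right_mul _ _ _) (mul_assoc (G := G) _ _ _).symm) }
    (ofHomComp _ _).symm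

end

end Biset

/-! ### The double Burnside group and its linearization -/

/-- Isomorphism classes of `(H, G)`-bisets. -/
def BisetClass (H G : Type u) [Group H] [Group G] : Type (u + 1) := Quotient (Biset.setoid H G)

namespace BisetClass

variable {H G : Type u} [Group H] [Group G]

/-- The isomorphism class of a biset. -/
def mk (X : Biset H G) : BisetClass H G := Quotient.mk _ X

theorem mk_eq {X Y : Biset H G} (e : Biset.Iso X Y) : mk X = mk Y := Quotient.sound ⟨e⟩

theorem ind {p : BisetClass H G → Prop} (h : ∀ X, p (mk X)) (c : BisetClass H G) : p c :=
  Quotient.ind h c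

/-- Addition of isomorphism classes is induced by the disjoint union. -/
instance : Add (BisetClass H G) :=
  ⟨Quotient.map₂ Biset.disjUnion fun _ _ ⟨e⟩ _ _ ⟨f⟩ => ⟨Biset.disjUnionCongr e f⟩⟩

/-- The zero element is the class of the empty biset. -/
instance : Zero (BisetClass H G) := ⟨mk (Biset.empty H G)⟩

theorem mk_add (X Y : Biset H G) : mk X + mk Y = mk (X.disjUnion Y) := rfl

theorem add_comm' (a b : BisetClass H G) : a + b = b + a := by
  revert a b
  exact ind fun X => ind fun Y => mk_eq
    { toEquiv := Equiv.sumComm _ _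
      map_left := by rintro h (x | x) <;> rfl
      map_right := by rintro (x | x) g <;> rfl }

theorem add_assoc' (a b c : BisetClass H G) : a + b + c = a + (b + c) := by
  revert a b c
  exact ind fun X => ind fun Y => ind fun Z => mk_eq
    { toEquiv := Equiv.sumAssoc _ _ _
      map_left := by rintro h ((x | x) | x) <;> rfl
      map_right := by rintro ((x | x) | x) g <;> rfl }

theorem zero_add' (a : BisetClass H G) : 0 + a = a := by
  revert a
  exact ind fun X => mk_eq (X := (Biset.empty H G).disjUnion X)
    { toEquiv := Equiv.emptySum PEmpty X.carrier
      map_left := by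
        rintro h (x | x)
        · exact x.elim
        · rfl
      map_right := by
        rintro (x | x) g
        · exact x.elim
        · rfl }

/-- Isomorphism classes of bisets form a commutative monoid under disjoint union. -/
instance : AddCommMonoid (BisetClass H G) where
  add_assoc := add_assoc'
  zero_add := zero_add'
  add_zero a := (add_comm' a 0).trans (zero_add' a)
  add_comm := add_comm'
  nsmul := nsmulRec

/-- A function on bisets that is invariant under isomorphisms and additive on disjoint unions
induces a homomorphism of monoids into any abelian group. -/
def lift {M : Type w} [AddCommGroup M] (f : Biset H G → M)
    (hiso : ∀ X Y, Biset.Iso X Y → f X = f Y)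
    (hadd : ∀ X Y, f (X.disjUnion Y) = f X + f Y) : BisetClass H G →+ M :=
  { toFun := Quotient.lift f fun X Y h => Nonempty.elim h fun e => hiso X Y e
    map_zero' := by
      have h0 : mk (Biset.empty H G) + mk (Biset.empty H G) = mk (Biset.empty H G) :=
        zero_add (0 : BisetClass H G)
      have h1 : f (Biset.empty H G) = f (Biset.empty H G) + f (Biset.empty H G) :=
        (congrArg (Quotient.lift f fun X Y h => Nonempty.elim h fun e => hiso X Y e)
          h0).symm.trans (hadd _ _)
      exact left_eq_add.mp h1
    map_add' := ind fun X => ind fun Y => hadd X Y }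

end BisetClass

/-- The group `B(H, G)`: the Grothendieck group of `(H, G)`-bisets with respect to disjoint
unions. -/
abbrev BurnsideGroup (H G : Type u) [Group H] [Group G] : Type (u + 1) :=
  Algebra.GrothendieckAddGroup (BisetClass H G)

/-- The `k`-module `kB(H, G) = k ⊗ B(H, G)`. -/
abbrev LinBurnside (k : Type v) [CommRing k] (H G : Type u) [Group H] [Group G] :
    Type (max (u + 1) v) :=
  k ⊗[ℤ] BurnsideGroup H G

namespace LinBurnside

section

variable {k : Type v} [CommRing k] {H G : Type u} [Group H] [Group G]

variable (k) in
/-- The element of `kB(H, G)` defined by a biset. -/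
noncomputable def of (X : Biset H G) : LinBurnside k H G :=
  (1 : k) ⊗ₜ[ℤ] Algebra.GrothendieckAddGroup.of (BisetClass.mk X)

theorem of_eq {X Y : Biset H G} (e : Biset.Iso X Y) : of k X = of k Y := by
  rw [of, of, BisetClass.mk_eq e]

theorem of_disjUnion (X Y : Biset H G) : of k (X.disjUnion Y) = of k X + of k Y := by
  rw [of, of, of, ← BisetClass.mk_add, map_add, TensorProduct.tmul_add]

theorem hom_ext {M : Type w} [AddCommGroup M] [Module k M] {f g : LinBurnside k H G →ₗ[k] M}
    (h : ∀ X, f (of k X) = g (of k X)) : f = g := by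
  apply TensorProduct.AlgebraTensorModule.ext
  intro a b
  have hb : (f.toAddMonoidHom.comp (TensorProduct.mk ℤ k (BurnsideGroup H G) 1).toAddMonoidHom) =
      (g.toAddMonoidHom.comp (TensorProduct.mk ℤ k (BurnsideGroup H G) 1).toAddMonoidHom) := by
    apply Algebra.GrothendieckAddGroup.lift.symm.injective
    ext c
    revert c
    exact BisetClass.ind fun X => h X
  have hb' : f ((1 : k) ⊗ₜ[ℤ] b) = g ((1 : k) ⊗ₜ[ℤ] b) := DFunLike.congr_fun hb b
  have ha : a ⊗ₜ[ℤ] b = a • ((1 : k) ⊗ₜ[ℤ] b) := by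
    rw [TensorProduct.smul_tmul', smul_eq_mul, mul_one]
  rw [ha, map_smul, map_smul, hb']

/-- A function on bisets that is invariant under isomorphisms and additive on disjoint unions
extends to a linear map on `kB(H, G)`. -/
noncomputable def lift {M : Type w} [AddCommGroup M] [Module k M] (f : Biset H G → M)
    (hiso : ∀ X Y, Biset.Iso X Y → f X = f Y)
    (hadd : ∀ X Y, f (X.disjUnion Y) = f X + f Y) : LinBurnside k H G →ₗ[k] M :=
  LinearMap.liftBaseChange k (AddMonoidHom.toIntLinearMap
    (Algebra.GrothendieckAddGroup.lift (BisetClass.lift f hiso hadd)))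

@[simp]
theorem lift_of {M : Type w} [AddCommGroup M] [Module k M] (f : Biset H G → M)
    (hiso : ∀ X Y, Biset.Iso X Y → f X = f Y)
    (hadd : ∀ X Y, f (X.disjUnion Y) = f X + f Y) (X : Biset H G) :
    lift (k := k) f hiso hadd (of k X) = f X := by
  have h := DFunLike.congr_fun (Algebra.GrothendieckAddGroup.lift.symm_apply_apply
    (BisetClass.lift f hiso hadd)) (BisetClass.mk X)
  rw [lift, of, LinearMap.liftBaseChange_tmul, one_smul]
  exact h

end

section

variable (k : Type v) [CommRing k] {L K H G : Type u} [Group L] [Group K] [Group H] [Group G]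

/-- The bilinear extension to `kB` of an operation on bisets that respects isomorphisms and
disjoint unions. -/
noncomputable def lift₂ {P Q : Type u} [Group P] [Group Q]
    (F : Biset L K → Biset H G → Biset P Q)
    (hiso : ∀ Y Y' X X', Biset.Iso Y Y' → Biset.Iso X X' → Biset.Iso (F Y X) (F Y' X'))
    (hl : ∀ Y Y' X, Biset.Iso (F (Y.disjUnion Y') X) ((F Y X).disjUnion (F Y' X)))
    (hr : ∀ Y X X', Biset.Iso (F Y (X.disjUnion X')) ((F Y X).disjUnion (F Y X'))) :
    LinBurnside k L K →ₗ[k] LinBurnside k H G →ₗ[k] LinBurnside k P Q :=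
  lift
    (fun Y => lift (fun X => of k (F Y X))
      (fun X X' e => of_eq (hiso Y Y X X' (Biset.Iso.refl Y) e))
      (fun X X' => (of_eq (hr Y X X')).trans (of_disjUnion _ _)))
    (fun Y Y' e => hom_ext fun X => by
      rw [lift_of, lift_of]
      exact of_eq (hiso Y Y' X X e (Biset.Iso.refl X)))
    (fun Y Y' => hom_ext fun X => by
      rw [LinearMap.add_apply, lift_of, lift_of, lift_of, of_eq (hl Y Y' X), of_disjUnion])

/-- Composition `kB(K, H) × kB(H, G) → kB(K, G)`, the bilinear extension of the composition of
bisets. -/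
noncomputable def comp :
    LinBurnside k K H →ₗ[k] LinBurnside k H G →ₗ[k] LinBurnside k K G :=
  lift₂ k Biset.comp (fun _ _ _ _ => Biset.compCongr) Biset.disjUnionComp Biset.compDisjUnion

/-- The external product `kB(L, K) × kB(H, G) → kB(L × H, K × G)`, the bilinear extension of the
external product of bisets. -/
noncomputable def prod :
    LinBurnside k L K →ₗ[k] LinBurnside k H G →ₗ[k] LinBurnside k (L × H) (K × G) :=
  lift₂ k Biset.prod (fun _ _ _ _ => Biset.prodCongr) Biset.disjUnionProd Biset.prodDisjUnion

@[simp]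
theorem comp_of (Y : Biset K H) (X : Biset H G) : comp k (of k Y) (of k X) = of k (Y.comp X) := by
  rw [comp, lift₂, lift_of, lift_of]

@[simp]
theorem prod_of (Y : Biset L K) (X : Biset H G) : prod k (of k Y) (of k X) = of k (Y.prod X) := by
  rw [prod, lift₂, lift_of, lift_of]

theorem induction {p : LinBurnside k H G → Prop} (hof : ∀ X, p (of k X))
    (hadd : ∀ a b, p a → p b → p (a + b)) (hsmul : ∀ (r : k) a, p a → p (r • a))
    (a : LinBurnside k H G) : p a := by
  have hspan : Submodule.span k (Set.range (of k : Biset H G → LinBurnside k H G)) = ⊤ := by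
    rw [← Submodule.ker_mkQ (Submodule.span k _), LinearMap.ker_eq_top]
    apply hom_ext
    intro X
    rw [LinearMap.zero_apply, Submodule.mkQ_apply, Submodule.Quotient.mk_eq_zero]
    exact Submodule.subset_span ⟨X, rfl⟩
  have ha : a ∈ Submodule.span k (Set.range (of k : Biset H G → LinBurnside k H G)) := by
    rw [hspan]
    exact Submodule.mem_top
  induction ha using Submodule.span_induction with
  | mem x hx =>
    obtain ⟨X, rfl⟩ := hx
    exact hof X
  | zero => simpa using hsmul 0 _ (hof (Biset.empty H G))
  | add x y _ _ hx hy => exact hadd x y hx hy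
  | smul r x _ hx => exact hsmul r x hx

theorem comp_assoc {T : Type u} [Group T] (c : LinBurnside k L K) (b : LinBurnside k K H)
    (a : LinBurnside k H T) : comp k (comp k c b) a = comp k c (comp k b a) := by
  induction c using induction with
  | hadd x y hx hy => simp only [map_add, LinearMap.add_apply, hx, hy]
  | hsmul r x hx => simp only [map_smul, LinearMap.smul_apply, hx]
  | hof Z =>
    induction b using induction with
    | hadd x y hx hy => simp only [map_add, LinearMap.add_apply, hx, hy]
    | hsmul r x hx => simp only [map_smul, LinearMap.smul_apply, hx]
    | hof Y =>
      induction a using induction with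
      | hadd x y hx hy => simp only [map_add, hx, hy]
      | hsmul r x hx => simp only [map_smul, hx]
      | hof X =>
        simp only [comp_of]
        exact of_eq (Biset.compAssoc Z Y X)

theorem comp_add' (c : LinBurnside k K H) (a a' : LinBurnside k H G) :
    comp k c (a + a') = comp k c a + comp k c a' := map_add _ _ _

theorem add_comp' (c c' : LinBurnside k K H) (a : LinBurnside k H G) :
    comp k (c + c') a = comp k c a + comp k c' a := by rw [map_add, LinearMap.add_apply]

theorem comp_smul' (r : k) (c : LinBurnside k K H) (a : LinBurnside k H G) :
    comp k c (r • a) = r • comp k c a := map_smul _ _ _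

theorem smul_comp' (r : k) (c : LinBurnside k K H) (a : LinBurnside k H G) :
    comp k (r • c) a = r • comp k c a := by rw [map_smul, LinearMap.smul_apply]

theorem prod_comp_prod {K' H' G' : Type u} [Group K'] [Group H'] [Group G']
    (b : LinBurnside k K H) (a : LinBurnside k H G) (b' : LinBurnside k K' H')
    (a' : LinBurnside k H' G') :
    comp k (prod k b b') (prod k a a') = prod k (comp k b a) (comp k b' a') := by
  induction b using induction with
  | hadd x y hx hy => simp only [map_add, LinearMap.add_apply, hx, hy]
  | hsmul r x hx => simp only [map_smul, LinearMap.smul_apply, hx]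
  | hof Y =>
    induction a using induction with
    | hadd x y hx hy => simp only [map_add, LinearMap.add_apply, hx, hy]
    | hsmul r x hx => simp only [map_smul, LinearMap.smul_apply, hx]
    | hof X =>
      induction b' using induction with
      | hadd x y hx hy => simp only [map_add, LinearMap.add_apply, hx, hy]
      | hsmul r x hx => simp only [map_smul, LinearMap.smul_apply, hx]
      | hof Y' =>
        induction a' using induction with
        | hadd x y hx hy => simp only [map_add, hx, hy]
        | hsmul r x hx => simp only [map_smul, hx]
        | hof X' =>
          simp only [comp_of, prod_of]
          exact of_eq (Biset.prodCompProd Y X Y' X')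

theorem shift_nat {K' : Type u} [Group K'] [Finite K] [Finite H] [Finite L] [Finite K']
    [Finite G] (a : LinBurnside k L K) (b : LinBurnside k K' H) :
    comp k (prod k (prod k a b) (of k (Biset.id G))) (of k (Biset.shiftBiset K H G)) =
      comp k (of k (Biset.shiftBiset L K' G))
        (prod k (prod k a (of k (Biset.id G))) (prod k b (of k (Biset.id G)))) := by
  induction a using induction with
  | hadd x y hx hy => simp only [map_add, LinearMap.add_apply, hx, hy]
  | hsmul r x hx => simp only [map_smul, LinearMap.smul_apply, hx]
  | hof X =>
    induction b using induction with
    | hadd x y hx hy => simp only [map_add, LinearMap.add_apply, hx, hy]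
    | hsmul r x hx => simp only [map_smul, LinearMap.smul_apply, hx]
    | hof Y =>
      simp only [comp_of, prod_of]
      exact of_eq (Biset.shiftNat X Y)

theorem id_comp [Finite H] (a : LinBurnside k H G) : comp k (of k (Biset.id H)) a = a := by
  induction a using induction with
  | hadd x y hx hy => simp only [map_add, hx, hy]
  | hsmul r x hx => simp only [map_smul, hx]
  | hof X =>
    rw [comp_of]
    exact of_eq (Biset.idComp X)

theorem comp_id [Finite G] (a : LinBurnside k H G) : comp k a (of k (Biset.id G)) = a := by
  induction a using induction with
  | hadd x y hx hy => simp only [map_add, LinearMap.add_apply, hx, hy]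
  | hsmul r x hx => simp only [map_smul, LinearMap.smul_apply, hx]
  | hof X =>
    rw [comp_of]
    exact of_eq (Biset.compId X)

end

end LinBurnside

/-! ### Biset functors -/

/-- A class of finite groups that contains every group isomorphic to a subquotient of one of its
members or to a product of two of its members. It is the class of objects of a full
subcategory `𝒟` of the biset category. -/
structure AdmissibleClass : Type (u + 1) where
  mem : ∀ (G : Type u) [Group G] [Finite G], Prop
  exists_mem : ∃ (G : Type u) (_ : Group G) (_ : Finite G), mem G
  mem_of_subquotient : ∀ (G Q : Type u) [Group G] [Finite G] [Group Q] [Finite Q], mem G →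
    ∀ (S : Subgroup G) (N : Subgroup S) [N.Normal], Nonempty (Q ≃* S ⧸ N) → mem Q
  mem_of_prod : ∀ (G H P : Type u) [Group G] [Finite G] [Group H] [Finite H] [Group P] [Finite P],
    mem G → mem H → Nonempty (P ≃* G × H) → mem P

/-- The objects of `k𝒟`: the finite groups that belong to the class. -/
structure BisetCat (k : Type v) (D : AdmissibleClass.{u}) : Type (u + 1) where
  carrier : Type u
  [group : Group carrier]
  [finite : Finite carrier]
  mem : D.mem carrier

namespace BisetCat

section

variable {k : Type v} {D : AdmissibleClass.{u}}

instance (X : BisetCat k D) : Group X.carrier := X.group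

instance (X : BisetCat k D) : Finite X.carrier := X.finite

/-- The direct product of two groups of the class. -/
abbrev prod (X Y : BisetCat k D) : BisetCat k D where
  carrier := X.carrier × Y.carrier
  mem := D.mem_of_prod X.carrier Y.carrier _ X.mem Y.mem ⟨MulEquiv.refl _⟩

theorem mem_one (D : AdmissibleClass.{u}) : D.mem PUnit.{u + 1} := by
  obtain ⟨G, _, _, hG⟩ := D.exists_mem
  refine D.mem_of_subquotient G PUnit hG ⊤ ⊤ ⟨?_⟩
  have := QuotientGroup.subsingleton_quotient_top (G := (⊤ : Subgroup G))
  exact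
    { toFun := fun _ => 1
      invFun := fun _ => 1
      left_inv := fun _ => Subsingleton.elim _ _
      right_inv := fun _ => Subsingleton.elim _ _
      map_mul' := fun _ _ => Subsingleton.elim _ _ }

variable (k D) in
/-- The trivial group. -/
abbrev one : BisetCat k D where
  carrier := PUnit.{u + 1}
  mem := mem_one D

end

variable {k : Type v} [CommRing k] {D : AdmissibleClass.{u}}

/-- The category `k𝒟`: the morphisms from `G` to `H` are the elements of `kB(H, G)`. -/
noncomputable instance : Category.{max (u + 1) v} (BisetCat k D) where
  Hom X Y := LinBurnside k Y.carrier X.carrier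
  id X := LinBurnside.of k (Biset.id X.carrier)
  comp f g := LinBurnside.comp k g f
  id_comp f := LinBurnside.comp_id k f
  comp_id f := LinBurnside.id_comp k f
  assoc f g h := (LinBurnside.comp_assoc k h g f).symm

noncomputable instance : Preadditive (BisetCat k D) where
  homGroup X Y := inferInstanceAs (AddCommGroup (LinBurnside k Y.carrier X.carrier))
  add_comp _ _ _ f f' g := LinBurnside.comp_add' k g f f'
  comp_add _ _ _ f g g' := LinBurnside.add_comp' k g g' f

noncomputable instance : Linear k (BisetCat k D) where
  homModule X Y := inferInstanceAs (Module k (LinBurnside k Y.carrier X.carrier))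
  smul_comp _ _ _ r f g := LinBurnside.comp_smul' k r g f
  comp_smul _ _ _ f r g := LinBurnside.smul_comp' k r g f

/-- The morphism of `k𝒟` defined by a biset. -/
noncomputable def ofBiset {X Y : BisetCat k D} (B : Biset Y.carrier X.carrier) : X ⟶ Y :=
  LinBurnside.of k B

/-- The external product of two morphisms of `k𝒟`. -/
noncomputable def prodHom {K T H L : BisetCat k D} (α : K ⟶ T) (β : H ⟶ L) :
    K.prod H ⟶ T.prod L :=
  LinBurnside.prod k α β

theorem prodHom_comp {K T U H L M : BisetCat k D} (α : K ⟶ T) (α' : T ⟶ U) (β : H ⟶ L)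
    (β' : L ⟶ M) : prodHom (α ≫ α') (β ≫ β') = prodHom α β ≫ prodHom α' β' :=
  (LinBurnside.prod_comp_prod k α' α β' β).symm

theorem prodHom_id (K H : BisetCat k D) : prodHom (𝟙 K) (𝟙 H) = 𝟙 (K.prod H) :=
  (LinBurnside.prod_of k _ _).trans (LinBurnside.of_eq (Biset.ofHomProdOfHom _ _))

/-- The linear functor `H ↦ H × G`, `α ↦ α × Id_G`. -/
noncomputable def prodRight (G : BisetCat k D) : BisetCat k D ⥤ BisetCat k D where
  obj H := H.prod G
  map α := prodHom α (𝟙 G)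
  map_id H := prodHom_id H G
  map_comp α β := by
    rw [← prodHom_comp, Category.comp_id]

theorem prodHom_add_left {K T H L : BisetCat k D} (α α' : K ⟶ T) (β : H ⟶ L) :
    prodHom (α + α') β = prodHom α β + prodHom α' β :=
  LinearMap.map_add₂ (LinBurnside.prod k) α α' β

theorem prodHom_smul_left {K T H L : BisetCat k D} (r : k) (α : K ⟶ T) (β : H ⟶ L) :
    prodHom (r • α) β = r • prodHom α β :=
  LinearMap.map_smul₂ (LinBurnside.prod k) r α β

instance (G : BisetCat k D) : (prodRight G).Additive := ⟨prodHom_add_left _ _ _⟩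

instance (G : BisetCat k D) : (prodRight G).Linear k := ⟨fun α r => prodHom_smul_left r α _⟩

end BisetCat

/-- A biset functor for `𝒟` over `k`: a `k`-linear functor from `k𝒟` to `k`-modules. -/
structure BisetFunctor (k : Type v) [CommRing k] (D : AdmissibleClass.{u}) where
  functor : BisetCat k D ⥤ ModuleCat.{w} k
  additive : functor.Additive
  linear : functor.Linear k

namespace BisetFunctor

variable {k : Type v} [CommRing k] {D : AdmissibleClass.{u}}

/-- The value of a biset functor at a group. -/
abbrev obj (F : BisetFunctor.{u, v, w} k D) (H : BisetCat k D) : Type w := F.functor.obj H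

/-- The linear map `F(α)` for a morphism `α` of `k𝒟`. -/
noncomputable def map (F : BisetFunctor.{u, v, w} k D) {X Y : BisetCat k D} (α : X ⟶ Y) :
    F.obj X →ₗ[k] F.obj Y := (F.functor.map α).hom

/-- The linear map `F(B)` for a `(Y, X)`-biset `B`. -/
noncomputable def mapBiset (F : BisetFunctor.{u, v, w} k D) {X Y : BisetCat k D}
    (B : Biset Y.carrier X.carrier) : F.obj X →ₗ[k] F.obj Y := F.map (BisetCat.ofBiset B)

/-- The Yoneda-Dress construction of `F` at `G`: the biset functor `F_G` with
`F_G(H) = F(H × G)` and `F_G(α) = F(α × Id_G)`. -/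
noncomputable def shift (F : BisetFunctor.{u, v, w} k D) (G : BisetCat k D) :
    BisetFunctor.{u, v, w} k D where
  functor := BisetCat.prodRight G ⋙ F.functor
  additive := by
    have := F.additive
    infer_instance
  linear := by
    have := F.linear
    infer_instance

theorem map_comp (F : BisetFunctor.{u, v, w} k D) {X Y Z : BisetCat k D} (α : X ⟶ Y) (β : Y ⟶ Z)
    (a : F.obj X) : F.map (α ≫ β) a = F.map β (F.map α a) := by
  simp [map]

theorem map_id (F : BisetFunctor.{u, v, w} k D) (X : BisetCat k D) (a : F.obj X) :
    F.map (𝟙 X) a = a := by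
  simp [map]

theorem mapBiset_iso (F : BisetFunctor.{u, v, w} k D) {X Y : BisetCat k D}
    {B C : Biset Y.carrier X.carrier} (e : Biset.Iso B C) (a : F.obj X) :
    F.mapBiset B a = F.mapBiset C a := by
  rw [mapBiset, mapBiset, BisetCat.ofBiset, LinBurnside.of_eq e]
  rfl

theorem mapBiset_mapBiset (F : BisetFunctor.{u, v, w} k D) {X Y Z : BisetCat k D}
    (B : Biset Y.carrier X.carrier) (C : Biset Z.carrier Y.carrier) (a : F.obj X) :
    F.mapBiset C (F.mapBiset B a) = F.mapBiset (C.comp B) a := by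
  have h : BisetCat.ofBiset (k := k) (D := D) B ≫ BisetCat.ofBiset C =
      BisetCat.ofBiset (C.comp B) := LinBurnside.comp_of k C B
  rw [mapBiset, mapBiset, mapBiset, ← h, map_comp]

theorem mapBiset_ofHom_ofHom (F : BisetFunctor.{u, v, w} k D) {X Y Z : BisetCat k D}
    (φ : Y.carrier →* X.carrier) (ψ : Z.carrier →* Y.carrier) (a : F.obj X) :
    F.mapBiset (Biset.ofHom ψ) (F.mapBiset (Biset.ofHom φ) a) =
      F.mapBiset (Biset.ofHom (φ.comp ψ)) a :=
  (F.mapBiset_mapBiset _ _ a).trans (F.mapBiset_iso (Biset.ofHomCompOfHom ψ φ) a)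

theorem mapBiset_ofIso (F : BisetFunctor.{u, v, w} k D) {X Y : BisetCat k D}
    (ψ : X.carrier ≃* Y.carrier) (a : F.obj X) :
    F.mapBiset (Biset.ofIso ψ) a =
      F.mapBiset (Biset.ofHom (ψ.symm : Y.carrier →* X.carrier)) a :=
  F.mapBiset_iso (Biset.ofIsoIso ψ) a

theorem mapBiset_id (F : BisetFunctor.{u, v, w} k D) {X : BisetCat k D} (a : F.obj X) :
    F.mapBiset (Biset.ofHom (MonoidHom.id X.carrier)) a = a := F.map_id X a

theorem shift_mapBiset_ofHom (F : BisetFunctor.{u, v, w} k D)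
    (G : BisetCat k D) {X Y : BisetCat k D} (φ : Y.carrier →* X.carrier) (a : F.obj (X.prod G)) :
    (F.shift G).mapBiset (X := X) (Y := Y) (Biset.ofHom φ) a =
      F.mapBiset (X := X.prod G) (Y := Y.prod G)
        (Biset.ofHom (φ.prodMap (MonoidHom.id G.carrier))) a := by
  have h : BisetCat.prodHom (k := k) (D := D) (BisetCat.ofBiset (Biset.ofHom φ)) (𝟙 G) =
      BisetCat.ofBiset (X := X.prod G) (Y := Y.prod G)
        (Biset.ofHom (φ.prodMap (MonoidHom.id G.carrier))) :=
    (LinBurnside.prod_of k _ _).trans (LinBurnside.of_eq (Biset.ofHomProdOfHom φ _))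
  exact congrArg (fun α => F.map α a) h

end BisetFunctor

/-! ### Green biset functors -/

/-- A Green biset functor: a biset functor with an external product and an identity element. -/
structure GreenBisetFunctor (k : Type v) [CommRing k] (D : AdmissibleClass.{u}) extends
    BisetFunctor.{u, v, w} k D where
  /-- The bilinear products `A(K) × A(H) → A(K × H)`. -/
  times : ∀ K H : BisetCat k D,
    toBisetFunctor.obj K →ₗ[k] toBisetFunctor.obj H →ₗ[k] toBisetFunctor.obj (K.prod H)
  /-- The identity element in `A(1)`. -/
  eps : toBisetFunctor.obj (BisetCat.one k D)
  times_assoc : ∀ (L K H : BisetCat k D) (a : toBisetFunctor.obj L) (b : toBisetFunctor.obj K)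
    (c : toBisetFunctor.obj H),
    times (L.prod K) H (times L K a b) c =
      toBisetFunctor.mapBiset (X := L.prod (K.prod H)) (Y := (L.prod K).prod H)
        (Biset.ofIso MulEquiv.prodAssoc.symm) (times L (K.prod H) a (times K H b c))
  eps_times : ∀ (H : BisetCat k D) (a : toBisetFunctor.obj H),
    toBisetFunctor.mapBiset (X := (BisetCat.one k D).prod H) (Y := H)
      (Biset.ofIso MulEquiv.uniqueProd) (times (BisetCat.one k D) H eps a) = a
  times_eps : ∀ (H : BisetCat k D) (a : toBisetFunctor.obj H),
    toBisetFunctor.mapBiset (X := H.prod (BisetCat.one k D)) (Y := H)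
      (Biset.ofIso MulEquiv.prodUnique) (times H (BisetCat.one k D) a eps) = a
  map_times : ∀ {K T H L : BisetCat k D} (α : K ⟶ T) (β : H ⟶ L) (a : toBisetFunctor.obj K)
    (b : toBisetFunctor.obj H),
    toBisetFunctor.map (BisetCat.prodHom α β) (times K H a b) =
      times T L (toBisetFunctor.map α a) (toBisetFunctor.map β b)

namespace GreenBisetFunctor

variable {k : Type v} [CommRing k] {D : AdmissibleClass.{u}}

theorem times_mapBiset_ofHom (A : GreenBisetFunctor.{u, v, w} k D) {K T H L : BisetCat k D}
    (φ : T.carrier →* K.carrier) (ψ : L.carrier →* H.carrier) (a : A.obj K) (b : A.obj H) :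
    A.times T L (A.mapBiset (Biset.ofHom φ) a) (A.mapBiset (Biset.ofHom ψ) b) =
      A.mapBiset (X := K.prod H) (Y := T.prod L) (Biset.ofHom (φ.prodMap ψ)) (A.times K H a b) := by
  have h : BisetCat.prodHom (k := k) (D := D) (BisetCat.ofBiset (Biset.ofHom φ))
      (BisetCat.ofBiset (Biset.ofHom ψ)) =
      BisetCat.ofBiset (X := K.prod H) (Y := T.prod L) (Biset.ofHom (φ.prodMap ψ)) :=
    (LinBurnside.prod_of k _ _).trans (LinBurnside.of_eq (Biset.ofHomProdOfHom φ ψ))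
  have h' := A.map_times (BisetCat.ofBiset (Biset.ofHom φ)) (BisetCat.ofBiset (Biset.ofHom ψ)) a b
  rw [h] at h'
  exact h'.symm

/-- The product `a ×ᵈ b = A(K × G × H × G)(a × b)` on the shifted functor `A_G`. -/
noncomputable def shiftTimes (A : GreenBisetFunctor.{u, v, w} k D) (G K H : BisetCat k D) :
    A.obj (K.prod G) →ₗ[k] A.obj (H.prod G) →ₗ[k] A.obj ((K.prod H).prod G) :=
  (A.times (K.prod G) (H.prod G)).compr₂
    (A.mapBiset (X := (K.prod G).prod (H.prod G)) (Y := (K.prod H).prod G)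
      (Biset.shiftBiset K.carrier H.carrier G.carrier))

/-- The identity element `A(Inf_1^{1 × G})(ε_A)` of the shifted functor `A_G`. -/
noncomputable def shiftEps (A : GreenBisetFunctor.{u, v, w} k D) (G : BisetCat k D) :
    A.obj ((BisetCat.one k D).prod G) :=
  A.mapBiset (X := BisetCat.one k D) (Y := (BisetCat.one k D).prod G) (Biset.ofHom 1) A.eps

theorem shiftTimes_apply (A : GreenBisetFunctor.{u, v, w} k D) (G K H : BisetCat k D)
    (a : A.obj (K.prod G)) (b : A.obj (H.prod G)) :
    A.shiftTimes G K H a b = A.mapBiset (X := (K.prod G).prod (H.prod G))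
      (Y := (K.prod H).prod G)
      (Biset.ofHom (Biset.shiftDiag K.carrier H.carrier G.carrier))
      (A.times (K.prod G) (H.prod G) a b) := rfl

theorem times_mapBiset_left (A : GreenBisetFunctor.{u, v, w} k D) {K T L : BisetCat k D}
    (φ : T.carrier →* K.carrier) (a : A.obj K) (b : A.obj L) :
    A.times T L (A.mapBiset (Biset.ofHom φ) a) b =
      A.mapBiset (X := K.prod L) (Y := T.prod L)
        (Biset.ofHom (φ.prodMap (MonoidHom.id L.carrier))) (A.times K L a b) :=
  (congrArg _ (A.mapBiset_id b).symm).trans (A.times_mapBiset_ofHom φ _ a b)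

theorem times_mapBiset_right (A : GreenBisetFunctor.{u, v, w} k D) {T H L : BisetCat k D}
    (ψ : L.carrier →* H.carrier) (a : A.obj T) (b : A.obj H) :
    A.times T L a (A.mapBiset (Biset.ofHom ψ) b) =
      A.mapBiset (X := T.prod H) (Y := T.prod L)
        (Biset.ofHom ((MonoidHom.id T.carrier).prodMap ψ)) (A.times T H a b) :=
  (congrArg (fun t => A.times T L t _) (A.mapBiset_id a).symm).trans
    (A.times_mapBiset_ofHom _ ψ a b)

theorem shiftTimes_assoc (A : GreenBisetFunctor.{u, v, w} k D) (G L K H : BisetCat k D)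
    (a : A.obj (L.prod G)) (b : A.obj (K.prod G)) (c : A.obj (H.prod G)) :
    A.shiftTimes G (L.prod K) H (A.shiftTimes G L K a b) c =
      A.mapBiset (X := (L.prod (K.prod H)).prod G) (Y := ((L.prod K).prod H).prod G)
        (Biset.ofHom (((MulEquiv.prodAssoc.symm.symm :
          (L.carrier × K.carrier) × H.carrier ≃* L.carrier × K.carrier × H.carrier) :
          (L.carrier × K.carrier) × H.carrier →* L.carrier × K.carrier × H.carrier).prodMap
          (MonoidHom.id G.carrier)))
        (A.shiftTimes G L (K.prod H) a (A.shiftTimes G K H b c)) := by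
  rw [shiftTimes_apply, shiftTimes_apply, shiftTimes_apply, shiftTimes_apply,
    times_mapBiset_left, times_mapBiset_right, A.times_assoc, BisetFunctor.mapBiset_ofIso,
    BisetFunctor.mapBiset_ofHom_ofHom, BisetFunctor.mapBiset_ofHom_ofHom,
    BisetFunctor.mapBiset_ofHom_ofHom, BisetFunctor.mapBiset_ofHom_ofHom]
  rfl

theorem shiftEps_times (A : GreenBisetFunctor.{u, v, w} k D) (G H : BisetCat k D)
    (a : A.obj (H.prod G)) :
    A.mapBiset (X := ((BisetCat.one k D).prod H).prod G) (Y := H.prod G)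
        (Biset.ofHom (((MulEquiv.uniqueProd.symm :
          H.carrier ≃* PUnit.{u + 1} × H.carrier) : H.carrier →* _).prodMap
          (MonoidHom.id G.carrier)))
        (A.shiftTimes G (BisetCat.one k D) H (A.shiftEps G) a) = a := by
  have h := A.eps_times (H.prod G) a
  rw [BisetFunctor.mapBiset_ofIso] at h
  rw [shiftTimes_apply, shiftEps, times_mapBiset_left, BisetFunctor.mapBiset_ofHom_ofHom,
    BisetFunctor.mapBiset_ofHom_ofHom]
  exact h

theorem times_shiftEps (A : GreenBisetFunctor.{u, v, w} k D) (G H : BisetCat k D)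
    (a : A.obj (H.prod G)) :
    A.mapBiset (X := (H.prod (BisetCat.one k D)).prod G) (Y := H.prod G)
        (Biset.ofHom (((MulEquiv.prodUnique.symm :
          H.carrier ≃* H.carrier × PUnit.{u + 1}) : H.carrier →* _).prodMap
          (MonoidHom.id G.carrier)))
        (A.shiftTimes G H (BisetCat.one k D) a (A.shiftEps G)) = a := by
  have h := A.times_eps (H.prod G) a
  rw [BisetFunctor.mapBiset_ofIso] at h
  rw [shiftTimes_apply, shiftEps, times_mapBiset_right, BisetFunctor.mapBiset_ofHom_ofHom,
    BisetFunctor.mapBiset_ofHom_ofHom]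
  exact h

theorem map_shiftTimes (A : GreenBisetFunctor.{u, v, w} k D) (G : BisetCat k D)
    {K T H L : BisetCat k D} (α : K ⟶ T) (β : H ⟶ L) (a : A.obj (K.prod G))
    (b : A.obj (H.prod G)) :
    A.map (BisetCat.prodHom (BisetCat.prodHom α β) (𝟙 G)) (A.shiftTimes G K H a b) =
      A.shiftTimes G T L (A.map (BisetCat.prodHom α (𝟙 G)) a)
        (A.map (BisetCat.prodHom β (𝟙 G)) b) := by
  have h : BisetCat.ofBiset (X := (K.prod G).prod (H.prod G)) (Y := (K.prod H).prod G)
      (Biset.shiftBiset K.carrier H.carrier G.carrier) ≫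
        BisetCat.prodHom (BisetCat.prodHom α β) (𝟙 G) =
      BisetCat.prodHom (BisetCat.prodHom α (𝟙 G)) (BisetCat.prodHom β (𝟙 G)) ≫
        BisetCat.ofBiset (X := (T.prod G).prod (L.prod G)) (Y := (T.prod L).prod G)
          (Biset.shiftBiset T.carrier L.carrier G.carrier) :=
    LinBurnside.shift_nat k α β
  rw [shiftTimes, shiftTimes, LinearMap.compr₂_apply, LinearMap.compr₂_apply,
    BisetFunctor.mapBiset, BisetFunctor.mapBiset, ← A.map_comp, h, A.map_comp, A.map_times]

/-- The shifted functor `A_G` as a Green biset functor. -/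
noncomputable def shift (A : GreenBisetFunctor.{u, v, w} k D) (G : BisetCat k D) :
    GreenBisetFunctor.{u, v, w} k D where
  toBisetFunctor := A.toBisetFunctor.shift G
  times K H := A.shiftTimes G K H
  eps := A.shiftEps G
  times_assoc L K H a b c := (A.shiftTimes_assoc G L K H a b c).trans
    (((A.toBisetFunctor.shift G).mapBiset_ofIso (X := L.prod (K.prod H))
      (Y := (L.prod K).prod H) MulEquiv.prodAssoc.symm _).trans
      (A.toBisetFunctor.shift_mapBiset_ofHom G _ _)).symm
  eps_times H a := (((A.toBisetFunctor.shift G).mapBiset_ofIso (X := (BisetCat.one k D).prod H)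
      (Y := H) MulEquiv.uniqueProd _).trans
      (A.toBisetFunctor.shift_mapBiset_ofHom G _ _)).trans (A.shiftEps_times G H a)
  times_eps H a := (((A.toBisetFunctor.shift G).mapBiset_ofIso (X := H.prod (BisetCat.one k D))
      (Y := H) MulEquiv.prodUnique _).trans
      (A.toBisetFunctor.shift_mapBiset_ofHom G _ _)).trans (A.times_shiftEps G H a)
  map_times α β a b := A.map_shiftTimes G α β a b

/-! ### The essential support -/

/-- The composition `β ∘ α = A(L × ←K × H)(β × α)` of the associated category `𝒫_A`, whose
objects are those of `𝒟` and whose morphisms from `H` to `K` are the elements of `A(K × H)`. -/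
noncomputable def comp (A : GreenBisetFunctor.{u, v, w} k D) {L K H : BisetCat k D}
    (β : A.obj (L.prod K)) (α : A.obj (K.prod H)) : A.obj (L.prod H) :=
  A.mapBiset (X := (L.prod K).prod (K.prod H)) (Y := L.prod H)
    (Biset.contract L.carrier K.carrier H.carrier) (A.times (L.prod K) (K.prod H) β α)

/-- The submodule `I_A(H)` of `A(H × H)` generated by the endomorphisms of `H` in `𝒫_A` that
factor through a group of order smaller than the order of `H`. -/
def lowerIdeal (A : GreenBisetFunctor.{u, v, w} k D) (H : BisetCat k D) :
    Submodule k (A.obj (H.prod H)) :=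
  Submodule.span k {γ | ∃ K : BisetCat k D, Nat.card K.carrier < Nat.card H.carrier ∧
    ∃ (β : A.obj (H.prod K)) (α : A.obj (K.prod H)), γ = A.comp β α}

/-- The essential algebra `Â(H) = A(H × H) / I_A(H)`. -/
abbrev EssentialAlgebra (A : GreenBisetFunctor.{u, v, w} k D) (H : BisetCat k D) : Type w :=
  A.obj (H.prod H) ⧸ A.lowerIdeal H

/-- The essential support of `A`: the groups of `𝒟` whose essential algebra is nonzero. -/
def essentialSupport (A : GreenBisetFunctor.{u, v, w} k D) : Set (BisetCat k D) :=
  {H | Nontrivial (A.EssentialAlgebra H)}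

end GreenBisetFunctor

/-! A morphism of Green biset functors `A → B` commutes with bisets, products and identity elements,
so it induces a functor from the associated category of `A` to that of `B` which fixes every object.
A factorization of an endomorphism of `H` through a group `K` of smaller order is carried to a
factorization through the same `K`. The morphism thus sends `I_A(H)` into `I_B(H)` and the identity
of `H` to the identity of `H`.

By associativity of the composition `I_A(H)` is a right ideal, so by the left unit law `Â(H)`
vanishes exactly when `I_A(H)` contains the identity (`mem_essentialSupport`). If the identity lies
in `I_A(H)`, its image, the identity for `B`, lies in `I_B(H)`. A morphism `A → B` therefore forces
the support of `B` into that of `A` (`Hom.essentialSupport_subset`).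

It remains to find morphisms both ways between `A` and `A_G`. Inflation along `H × G → H` gives `A →
A_G`, and restriction along `H → H × G` gives `A_G → A`. Both commute with bisets because a morphism
`α` acts on `A_G` as `α × Id_G` and leaves the factor `G` alone. They respect products because both
homomorphisms are compatible with the diagonal of `G` that defines the product of `A_G`.

Every identity needed, associativity included, reduces to an isomorphism between explicit composites
of bisets. -/

namespace Biset

variable {M L K H G : Type u} [Group M] [Group L] [Group K] [Group H] [Group G]

/-! ### Isomorphisms out of a composite of bisets -/

/-- A balanced equivariant function on `Y × X` with a section that inverts it up to the action
of `H` induces an isomorphism from `Y ×_H X`. -/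
def compIso {Y : Biset K H} {X : Biset H G} {W : Biset K G}
    (f : Y.carrier → X.carrier → W.carrier)
    (balanced : ∀ y h x, f (Y.right y h) x = f y (X.left h x))
    (map_left : ∀ k y x, f (Y.left k y) x = W.left k (f y x))
    (map_right : ∀ y x g, f y (X.right x g) = W.right (f y x) g)
    (s : W.carrier → Y.carrier) (s' : W.carrier → X.carrier)
    (apply_section : ∀ w, f (s w) (s' w) = w)
    (t : Y.carrier → X.carrier → H)
    (right_section : ∀ y x, Y.right (s (f y x)) (t y x) = y)
    (left_section : ∀ y x, s' (f y x) = X.left (t y x) x) :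
    Iso (Y.comp X) W where
  toEquiv :=
    { toFun := compLift f balanced
      invFun := fun w => compMk Y X (s w) (s' w)
      -- For `w = f y x` and `t = t y x`, moving `t` across the tensor product gives `[s w, s' w] =
      -- [s w, t x] = [(s w) t, x] = [y, x]`. So `t` is an explicit witness that the section picks a
      -- representative of the orbit of `(y, x)`.
      left_inv := comp_ind fun y x =>
        ((congrArg (compMk Y X (s (f y x))) (left_section y x)).trans
          (compMk_balanced Y X _ _ _).symm).trans
          (congrArg (fun z => compMk Y X z x) (right_section y x))
      right_inv := apply_section }
  map_left k := comp_ind (map_left k)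
  map_right z g := by
    revert z
    exact comp_ind fun y x => map_right y x g

variable [Finite M] [Finite L] [Finite K] [Finite H] [Finite G]

/-! ### Bisets behind associativity and the unit law in the associated category -/

/-- The biset `M × ←L × ←K × H`, which contracts the two inner pairs of factors of
`((M × L) × (L × K)) × (K × H)`. -/
def contract₂ (M L K H : Type u) [Group M] [Group L] [Group K] [Group H] [Finite M] [Finite L]
    [Finite K] [Finite H] : Biset (M × H) (((M × L) × (L × K)) × (K × H)) where
  carrier := M × L × K × H
  finite := inferInstance
  left a z := (a.1 * z.1, z.2.1, z.2.2.1, a.2 * z.2.2.2)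
  right z b := (z.1 * b.1.1.1, b.1.1.2⁻¹ * z.2.1 * b.1.2.1, b.1.2.2⁻¹ * z.2.2.1 * b.2.1,
    z.2.2.2 * b.2.2)
  one_left z := by simp
  mul_left a a' z := by simp [mul_assoc]
  right_one z := by simp
  right_mul z b b' := by simp [mul_assoc]
  left_right a z b := by simp [mul_assoc]

/-- The biset `M × ←L × ←K × H`, with its right factors bracketed to the right. -/
def contract₂' (M L K H : Type u) [Group M] [Group L] [Group K] [Group H] [Finite M] [Finite L]
    [Finite K] [Finite H] : Biset (M × H) ((M × L) × ((L × K) × (K × H))) where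
  carrier := M × L × K × H
  finite := inferInstance
  left a z := (a.1 * z.1, z.2.1, z.2.2.1, a.2 * z.2.2.2)
  right z b := (z.1 * b.1.1, b.1.2⁻¹ * z.2.1 * b.2.1.1, b.2.1.2⁻¹ * z.2.2.1 * b.2.2.1,
    z.2.2.2 * b.2.2.2)
  one_left z := by simp
  mul_left a a' z := by simp [mul_assoc]
  right_one z := by simp
  right_mul z b b' := by simp [mul_assoc]
  left_right a z b := by simp [mul_assoc]


/-- Passing to the opposite of `→K` inverts the acting pair, and the action of `→K` inverts its
second entry once more. The two inverses cancel there and leave the two-sided action `k₁⁻¹ x k₂` on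
which the contraction isomorphisms are computed. -/
theorem contract_right (z : L × K × H) (b : (L × K) × (K × H)) :
    (contract L K H).right z b =
      ((z.1 * b.1.1, b.1.2⁻¹ * z.2.1 * b.2.1, z.2.2 * b.2.2) : L × K × H) := by
  refine Prod.ext rfl (Prod.ext ?_ rfl)
  change b.1.2⁻¹ * z.2.1 * (b.2.1⁻¹)⁻¹ = _
  rw [inv_inv]

/-- Contracting the left pair first. -/
def contractCompLeft : Iso ((contract M K H).comp ((contract M L K).prod (id (K × H))))
    (contract₂ M L K H) :=
  compIso
    (fun (y : M × K × H) (x : (M × L × K) × (K × H)) =>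
      ((y.1 * x.1.1, x.1.2.1, x.1.2.2⁻¹ * y.2.1 * x.2.1, y.2.2 * x.2.2) : M × L × K × H))
    (fun (y : M × K × H) b (x : (M × L × K) × (K × H)) => by
      rw [contract_right]
      change (_, _, _, _) = (y.1 * (b.1.1 * x.1.1), x.1.2.1,
        (b.1.2 * x.1.2.2)⁻¹ * y.2.1 * (b.2.1 * x.2.1), y.2.2 * (b.2.2 * x.2.2))
      simp [mul_assoc])
    (fun a (y : M × K × H) (x : (M × L × K) × (K × H)) => by
      change (a.1 * y.1 * x.1.1, x.1.2.1, x.1.2.2⁻¹ * y.2.1 * x.2.1, a.2 * y.2.2 * x.2.2) =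
        (a.1 * (y.1 * x.1.1), x.1.2.1, x.1.2.2⁻¹ * y.2.1 * x.2.1, a.2 * (y.2.2 * x.2.2))
      simp [mul_assoc])
    (fun (y : M × K × H) (x : (M × L × K) × (K × H)) b => by
      have h : ((contract M L K).prod (id (K × H))).right x b =
          ((x.1.1 * b.1.1.1, b.1.1.2⁻¹ * x.1.2.1 * b.1.2.1, x.1.2.2 * b.1.2.2), x.2 * b.2) :=
        Prod.ext (contract_right x.1 b.1) rfl
      rw [h]
      change _ = (y.1 * x.1.1 * b.1.1.1, b.1.1.2⁻¹ * x.1.2.1 * b.1.2.1,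
        b.1.2.2⁻¹ * (x.1.2.2⁻¹ * y.2.1 * x.2.1) * b.2.1, y.2.2 * x.2.2 * b.2.2)
      simp [mul_assoc])
    -- The right action on `M × ←K × H` is transitive, so every orbit has a representative whose
    -- first entry is the base point `(1, 1, 1)`.
    (fun _ => ((1, 1, 1) : M × K × H))
    (fun (w : M × L × K × H) => (((w.1, w.2.1, 1), (w.2.2.1, w.2.2.2)) : (M × L × K) × (K × H)))
    (fun (w : M × L × K × H) => by
      simp
      rfl)
    -- The elements that carry `(1, 1, 1)` to `y` form a coset of a copy of `K`. This freedom is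
    -- spent on turning the `K`-coordinate of the first factor of `x` into `1`, which forces the
    -- entry `x.1.2.2⁻¹`.
    (fun (y : M × K × H) (x : (M × L × K) × (K × H)) =>
      ((y.1, x.1.2.2⁻¹), (x.1.2.2⁻¹ * y.2.1, y.2.2)))
    (fun (y : M × K × H) (x : (M × L × K) × (K × H)) => by
      rw [contract_right]
      simp
      rfl)
    (fun (y : M × K × H) (x : (M × L × K) × (K × H)) => by
      change (_ : (M × L × K) × (K × H)) = ((y.1 * x.1.1, x.1.2.1, x.1.2.2⁻¹ * x.1.2.2),
        (x.1.2.2⁻¹ * y.2.1 * x.2.1, y.2.2 * x.2.2))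
      simp)

/-- Contracting the right pair first. -/
def contractCompRight : Iso ((contract M L H).comp ((id (M × L)).prod (contract L K H)))
    (contract₂' M L K H) :=
  compIso
    (fun (y : M × L × H) (x : (M × L) × (L × K × H)) =>
      ((y.1 * x.1.1, x.1.2⁻¹ * y.2.1 * x.2.1, x.2.2.1, y.2.2 * x.2.2.2) : M × L × K × H))
    (fun (y : M × L × H) b (x : (M × L) × (L × K × H)) => by
      rw [contract_right]
      change (_, _, _, _) = (y.1 * (b.1.1 * x.1.1), (b.1.2 * x.1.2)⁻¹ * y.2.1 * (b.2.1 * x.2.1),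
        x.2.2.1, y.2.2 * (b.2.2 * x.2.2.2))
      simp [mul_assoc])
    (fun a (y : M × L × H) (x : (M × L) × (L × K × H)) => by
      change (a.1 * y.1 * x.1.1, x.1.2⁻¹ * y.2.1 * x.2.1, x.2.2.1, a.2 * y.2.2 * x.2.2.2) =
        (a.1 * (y.1 * x.1.1), x.1.2⁻¹ * y.2.1 * x.2.1, x.2.2.1, a.2 * (y.2.2 * x.2.2.2))
      simp [mul_assoc])
    (fun (y : M × L × H) (x : (M × L) × (L × K × H)) b => by
      have h : ((id (M × L)).prod (contract L K H)).right x b =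
          (x.1 * b.1, (x.2.1 * b.2.1.1, b.2.1.2⁻¹ * x.2.2.1 * b.2.2.1, x.2.2.2 * b.2.2.2)) :=
        Prod.ext rfl (contract_right x.2 b.2)
      rw [h]
      change _ = (y.1 * x.1.1 * b.1.1, b.1.2⁻¹ * (x.1.2⁻¹ * y.2.1 * x.2.1) * b.2.1.1,
        b.2.1.2⁻¹ * x.2.2.1 * b.2.2.1, y.2.2 * x.2.2.2 * b.2.2.2)
      simp [mul_assoc])
    (fun _ => ((1, 1, 1) : M × L × H))
    (fun (w : M × L × K × H) => (((w.1, 1), (w.2.1, w.2.2.1, w.2.2.2)) : (M × L) × (L × K × H)))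
    (fun (w : M × L × K × H) => by
      simp
      rfl)
    -- Again the element carries `(1, 1, 1)` to `y`. The remaining freedom, now a copy of `L`, makes
    -- the `L`-coordinate of the first factor of `x` equal to `1`.
    (fun (y : M × L × H) (x : (M × L) × (L × K × H)) =>
      ((y.1, x.1.2⁻¹), (x.1.2⁻¹ * y.2.1, y.2.2)))
    (fun (y : M × L × H) (x : (M × L) × (L × K × H)) => by
      rw [contract_right]
      simp
      rfl)
    (fun (y : M × L × H) (x : (M × L) × (L × K × H)) => by
      change (_ : (M × L) × (L × K × H)) = ((y.1 * x.1.1, x.1.2⁻¹ * x.1.2),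
        (x.1.2⁻¹ * y.2.1 * x.2.1, x.2.2.1, y.2.2 * x.2.2.2))
      simp)

/-- The two bracketings of `M × ←L × ←K × H` differ by the associativity isomorphism. -/
def contract₂CompIso : Iso ((contract₂ M L K H).comp (ofIso MulEquiv.prodAssoc.symm))
    (contract₂' M L K H) :=
  -- The biset of an isomorphism only relabels the right action, so the orbit of `(y, x)` is
  -- determined by `y x` and is represented by `(y x, 1)`.
  compIso (fun y x => (contract₂ M L K H).right y x)
    (fun y b x => ((contract₂ M L K H).right_mul y b x).symm)
    (fun a y x => ((contract₂ M L K H).left_right a y x).symm)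
    (fun y x b => (contract₂ M L K H).right_mul y x (MulEquiv.prodAssoc.symm b))
    (fun w => w) (fun _ => (1 : ((M × L) × (L × K)) × (K × H)))
    (fun w => (contract₂ M L K H).right_one w)
    (fun _ (x : ((M × L) × (L × K)) × (K × H)) => x⁻¹)
    (fun y (x : ((M × L) × (L × K)) × (K × H)) => by rw [← right_mul, mul_inv_cancel, right_one])
    (fun _ (x : ((M × L) × (L × K)) × (K × H)) => (inv_mul_cancel x).symm)

/-- The biset `→H` is a left identity for contraction. -/
def contractDiag : Iso ((contract H H K).comp ((diag H).prod (id (H × K))))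
    (ofIso MulEquiv.uniqueProd) :=
  compIso
    (fun (y : H × H × K) (x : H × (H × K)) =>
      ((y.1 * x.1 * y.2.1 * x.2.1, y.2.2 * x.2.2) : H × K))
    (fun (y : H × H × K) b (x : H × (H × K)) => by
      rw [contract_right]
      change (_, _) = (y.1 * (b.1.1 * x.1 * b.1.2⁻¹) * y.2.1 * (b.2.1 * x.2.1),
        y.2.2 * (b.2.2 * x.2.2))
      simp [mul_assoc])
    (fun a (y : H × H × K) (x : H × (H × K)) => by
      change (a.1 * y.1 * x.1 * y.2.1 * x.2.1, a.2 * y.2.2 * x.2.2) =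
        (a.1 * (y.1 * x.1 * y.2.1 * x.2.1), a.2 * (y.2.2 * x.2.2))
      simp [mul_assoc])
    (fun (y : H × H × K) (x : H × (H × K)) b => by
      change (y.1 * x.1 * y.2.1 * (x.2.1 * b.2.1), y.2.2 * (x.2.2 * b.2.2)) =
        (y.1 * x.1 * y.2.1 * x.2.1 * b.2.1, y.2.2 * x.2.2 * b.2.2)
      simp [mul_assoc])
    (fun _ => ((1, 1, 1) : H × H × K))
    (fun (w : H × K) => ((1, w) : H × (H × K)))
    (fun (w : H × K) => by
      simp
      rfl)
    -- The `H`-entries are the successive partial products of the word `y.1 * x.1 * y.2.1 * x.2.1`.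
    -- They carry `(1, 1, 1)` to `y` and move the whole word into the last `H`-coordinate of `x`,
    -- leaving `1` in `→H`.
    (fun (y : H × H × K) (x : H × (H × K)) => ((y.1, y.1 * x.1), (y.1 * x.1 * y.2.1, y.2.2)))
    (fun (y : H × H × K) (x : H × (H × K)) => by
      rw [contract_right]
      simp [mul_assoc]
      rfl)
    (fun (y : H × H × K) (x : H × (H × K)) => by
      change (_ : H × (H × K)) = (y.1 * x.1 * (y.1 * x.1)⁻¹,
        (y.1 * x.1 * y.2.1 * x.2.1, y.2.2 * x.2.2))
      simp)

/-! ### Naturality of inflation and restriction at the level of bisets -/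

/-- Inflation along the projection `H × G → H` is natural in `H`. -/
def inflationNat (X : Biset K H) : Iso ((X.prod (id G)).comp (ofHom (MonoidHom.fst H G)))
    ((ofHom (MonoidHom.fst K G)).comp X) :=
  -- Both composites are compared with `X` itself, where `K × G` acts on the left through its
  -- projection to `K`.
  (compIso (Y := X.prod (id G)) (X := ofHom (MonoidHom.fst H G))
    (W := ⟨X.carrier, X.finite, fun a => X.left (MonoidHom.fst K G a), X.right, fun _ => X.one_left _,
      fun _ _ _ => X.mul_left _ _ _, X.right_one, X.right_mul, fun _ _ _ => X.left_right _ _ _⟩)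
    (fun (y : X.carrier × G) (x : H) => X.right y.1 x)
    (fun y b x => (X.right_mul y.1 b.1 x).symm)
    (fun a y x => (X.left_right a.1 y.1 x).symm)
    (fun y x b => X.right_mul y.1 x b)
    (fun w => ((w, 1) : X.carrier × G)) (fun _ => (1 : H))
    (fun w => X.right_one w)
    -- The factor `G` acts trivially on `H`, so the second entry is free and can be chosen to
    -- recover the `G`-coordinate of `y` from `1`.
    (fun (y : X.carrier × G) (x : H) => (x⁻¹, y.2))
    (fun (y : X.carrier × G) (x : H) => Prod.ext
      ((X.right_mul y.1 x x⁻¹).symm.trans (by rw [mul_inv_cancel, X.right_one])) (one_mul y.2))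
    (fun _ (x : H) => (inv_mul_cancel x).symm)).trans
    (ofHomComp (MonoidHom.fst K G) X).symm

/-- Restriction along the inclusion `H → H × G` is natural in `H`. -/
def restrictionNat (X : Biset K H) : Iso ((ofHom (MonoidHom.inl K G)).comp (X.prod (id G)))
    (X.comp (ofHom (MonoidHom.inl H G))) :=
  -- The common value of both composites is `X × G` with `K` acting on the factor `X` only.
  (ofHomComp _ (X.prod (id G))).trans
    (compIso (fun (y : X.carrier) (x : H × G) => ((X.right y x.1, x.2) : X.carrier × G))
      (fun y b (x : H × G) => Prod.ext (X.right_mul y b x.1).symm (one_mul x.2).symm)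
      (fun a y (x : H × G) => Prod.ext (X.left_right a y x.1).symm (one_mul x.2).symm)
      (fun y (x : H × G) (b : H × G) =>
        congrArg (fun z => (z, x.2 * b.2)) (X.right_mul y x.1 b.1))
      (fun (w : X.carrier × G) => w.1) (fun (w : X.carrier × G) => ((1, w.2) : H × G))
      (fun (w : X.carrier × G) => congrArg (fun z => (z, w.2)) (X.right_one w.1))
      (fun _ (x : H × G) => x.1⁻¹)
      (fun y (x : H × G) => by rw [← right_mul, mul_inv_cancel, right_one])
      (fun _ (x : H × G) => Prod.ext (inv_mul_cancel x.1).symm (one_mul x.2).symm)).symm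

end Biset

/-! ### Products in a Green biset functor and the action of bisets -/

namespace GreenBisetFunctor

variable {k : Type v} [CommRing k] {D : AdmissibleClass.{u}}

/-- This is the compatibility axiom `map_times` for morphisms given by single bisets; with an
identity biset on one side it lets a biset be pulled out of either factor of a product. -/
theorem times_mapBiset (A : GreenBisetFunctor.{u, v, w} k D) {K T H L : BisetCat k D}
    (Y : Biset T.carrier K.carrier) (X : Biset L.carrier H.carrier) (a : A.obj K) (b : A.obj H) :
    A.times T L (A.mapBiset Y a) (A.mapBiset X b) =
      A.mapBiset (X := K.prod H) (Y := T.prod L) (Y.prod X) (A.times K H a b) := by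
  have h : BisetCat.prodHom (k := k) (D := D) (BisetCat.ofBiset Y) (BisetCat.ofBiset X) =
      BisetCat.ofBiset (X := K.prod H) (Y := T.prod L) (Y.prod X) := LinBurnside.prod_of k _ _
  have h' := A.map_times (BisetCat.ofBiset Y) (BisetCat.ofBiset X) a b
  rw [h] at h'
  exact h'.symm

theorem mapBiset_times (A : GreenBisetFunctor.{u, v, w} k D) {K T L : BisetCat k D}
    (Y : Biset T.carrier K.carrier) (a : A.obj K) (b : A.obj L) :
    A.times T L (A.mapBiset Y a) b =
      A.mapBiset (X := K.prod L) (Y := T.prod L) (Y.prod (Biset.id L.carrier))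
        (A.times K L a b) :=
  (congrArg _ (A.mapBiset_id b).symm).trans (A.times_mapBiset Y _ a b)

theorem times_mapBiset' (A : GreenBisetFunctor.{u, v, w} k D) {T H L : BisetCat k D}
    (X : Biset L.carrier H.carrier) (a : A.obj T) (b : A.obj H) :
    A.times T L a (A.mapBiset X b) =
      A.mapBiset (X := T.prod H) (Y := T.prod L) ((Biset.id T.carrier).prod X)
        (A.times T H a b) :=
  (congrArg (fun t => A.times T L t _) (A.mapBiset_id a).symm).trans
    (A.times_mapBiset _ X a b)

/-! ### The associated category -/

/-- The composition of the associated category is associative. -/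
theorem comp_assoc (A : GreenBisetFunctor.{u, v, w} k D) {M L K H : BisetCat k D}
    (c : A.obj (M.prod L)) (b : A.obj (L.prod K)) (a : A.obj (K.prod H)) :
    A.comp (A.comp c b) a = A.comp c (A.comp b a) := by
  -- Pulling all bisets out of the products and reassociating turns each side into one biset applied
  -- to `c × (b × a)`. It then suffices that the two bisets are isomorphic, both being `M × ←L × ←K
  -- × H`.
  rw [comp, comp, comp, comp, mapBiset_times, times_mapBiset', A.times_assoc,
    BisetFunctor.mapBiset_mapBiset, BisetFunctor.mapBiset_mapBiset,
    BisetFunctor.mapBiset_mapBiset]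
  exact A.mapBiset_iso (X := (M.prod L).prod ((L.prod K).prod (K.prod H))) (Y := M.prod H)
    (((Biset.compCongr Biset.contractCompLeft (Biset.Iso.refl _)).trans
      Biset.contract₂CompIso).trans Biset.contractCompRight.symm) _

/-- The identity `A(→H)(ε_A)` of `H` in the associated category. -/
noncomputable def one (A : GreenBisetFunctor.{u, v, w} k D) (H : BisetCat k D) :
    A.obj (H.prod H) :=
  A.mapBiset (X := BisetCat.one k D) (Y := H.prod H) (Biset.diag H.carrier) A.eps

/-- The biset `→H` cancels against one side of the contraction, which leaves the canonical
isomorphism `1 × (H × K) → H × K` and hence the unit axiom for `ε_A`. -/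
theorem one_comp (A : GreenBisetFunctor.{u, v, w} k D) {H K : BisetCat k D}
    (a : A.obj (H.prod K)) : A.comp (A.one H) a = a := by
  rw [comp, one, mapBiset_times, BisetFunctor.mapBiset_mapBiset]
  exact (A.mapBiset_iso (X := (BisetCat.one k D).prod (H.prod K)) (Y := H.prod K)
    Biset.contractDiag _).trans (A.eps_times (H.prod K) a)

/-- By associativity, precomposing a morphism that factors through `K` changes only the first arrow
of the factorization. So `I_A(H)` is a right ideal. -/
theorem comp_mem_lowerIdeal (A : GreenBisetFunctor.{u, v, w} k D) {H : BisetCat k D}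
    {x : A.obj (H.prod H)} (hx : x ∈ A.lowerIdeal H) (a : A.obj (H.prod H)) :
    A.comp x a ∈ A.lowerIdeal H := by
  induction hx using Submodule.span_induction with
  | mem x hx =>
    obtain ⟨K, hK, β, α, rfl⟩ := hx
    exact Submodule.subset_span ⟨K, hK, β, A.comp α a, A.comp_assoc β α a⟩
  | zero => simp [comp]
  | add x y _ _ hx hy =>
    rw [comp, map_add, LinearMap.add_apply, map_add]
    exact add_mem hx hy
  | smul r x _ hx =>
    rw [comp, map_smul, LinearMap.smul_apply, map_smul]
    exact Submodule.smul_mem _ r hx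

/-- A right ideal that contains the identity contains every `a`, since `a` is the identity composed
with `a`. Nonvanishing of the essential algebra thus becomes a condition on one element, which
morphisms can transport. -/
theorem mem_essentialSupport (A : GreenBisetFunctor.{u, v, w} k D) {H : BisetCat k D} :
    H ∈ A.essentialSupport ↔ A.one H ∉ A.lowerIdeal H := by
  rw [essentialSupport, Set.mem_ofPred_eq, EssentialAlgebra, Submodule.Quotient.nontrivial_iff,
    not_iff_not, Submodule.eq_top_iff']
  refine ⟨fun h => h _, fun h a => ?_⟩
  have h' := A.comp_mem_lowerIdeal h a
  rwa [one_comp] at h'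

/-! ### Morphisms of Green biset functors -/

/-- A morphism of Green biset functors: a family of linear maps that commute with the action of
bisets, preserve products and preserve the identity element. -/
structure Hom (A B : GreenBisetFunctor.{u, v, w} k D) where
  app : ∀ H : BisetCat k D, A.obj H →ₗ[k] B.obj H
  app_mapBiset : ∀ {H K : BisetCat k D} (X : Biset K.carrier H.carrier) (a : A.obj H),
    app K (A.mapBiset X a) = B.mapBiset X (app H a)
  app_times : ∀ (K H : BisetCat k D) (a : A.obj K) (b : A.obj H),
    app (K.prod H) (A.times K H a b) = B.times K H (app K a) (app H b)
  app_eps : app (BisetCat.one k D) A.eps = B.eps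

namespace Hom

variable {A B : GreenBisetFunctor.{u, v, w} k D}

theorem app_comp (f : Hom A B) {L K H : BisetCat k D} (b : A.obj (L.prod K))
    (a : A.obj (K.prod H)) :
    f.app (L.prod H) (A.comp b a) = B.comp (f.app (L.prod K) b) (f.app (K.prod H) a) := by
  rw [GreenBisetFunctor.comp, GreenBisetFunctor.comp, f.app_mapBiset, f.app_times]

theorem app_one (f : Hom A B) (H : BisetCat k D) : f.app (H.prod H) (A.one H) = B.one H := by
  rw [GreenBisetFunctor.one, GreenBisetFunctor.one, f.app_mapBiset, f.app_eps]

/-- Each generator goes to a generator with the same intermediate group `K`, so the bound on its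
order persists. -/
theorem app_mem_lowerIdeal (f : Hom A B) {H : BisetCat k D} {x : A.obj (H.prod H)}
    (hx : x ∈ A.lowerIdeal H) : f.app (H.prod H) x ∈ B.lowerIdeal H := by
  suffices h : A.lowerIdeal H ≤ (B.lowerIdeal H).comap (f.app (H.prod H)) from h hx
  refine Submodule.span_le.2 ?_
  rintro _ ⟨K, hK, β, α, rfl⟩
  exact Submodule.subset_span ⟨K, hK, _, _, f.app_comp β α⟩

/-- A morphism from `A` to `B` forces the essential support of `B` into that of `A`. -/
theorem essentialSupport_subset (f : Hom A B) : B.essentialSupport ⊆ A.essentialSupport := by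
  intro H hH
  rw [mem_essentialSupport] at hH ⊢
  exact fun h => hH (f.app_one H ▸ f.app_mem_lowerIdeal h)

end Hom

/-! ### Inflation and restriction as morphisms between `A` and `A_G` -/

theorem shift_mapBiset (A : GreenBisetFunctor.{u, v, w} k D) (G : BisetCat k D)
    {H K : BisetCat k D} (X : Biset K.carrier H.carrier) (a : A.obj (H.prod G)) :
    (A.shift G).mapBiset X a =
      A.mapBiset (X := H.prod G) (Y := K.prod G) (X.prod (Biset.id G.carrier)) a := by
  have h : BisetCat.prodHom (k := k) (D := D) (BisetCat.ofBiset X) (𝟙 G) =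
      BisetCat.ofBiset (X := H.prod G) (Y := K.prod G) (X.prod (Biset.id G.carrier)) :=
    LinBurnside.prod_of k _ _
  exact congrArg (fun α => A.map α a) h

/-- Inflation `A(H) → A(H × G)` along the projection `H × G → H`. -/
noncomputable def inflate (A : GreenBisetFunctor.{u, v, w} k D) (G H : BisetCat k D) :
    A.obj H →ₗ[k] A.obj (H.prod G) :=
  A.mapBiset (X := H) (Y := H.prod G) (Biset.ofHom (MonoidHom.fst H.carrier G.carrier))

/-- Restriction `A(H × G) → A(H)` along the inclusion `H → H × G`. -/
noncomputable def restrict (A : GreenBisetFunctor.{u, v, w} k D) (G H : BisetCat k D) :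
    A.obj (H.prod G) →ₗ[k] A.obj H :=
  A.mapBiset (X := H.prod G) (Y := H) (Biset.ofHom (MonoidHom.inl H.carrier G.carrier))

theorem inflate_mapBiset (A : GreenBisetFunctor.{u, v, w} k D) (G : BisetCat k D)
    {H K : BisetCat k D} (X : Biset K.carrier H.carrier) (a : A.obj H) :
    A.inflate G K (A.mapBiset X a) =
      A.mapBiset (X := H.prod G) (Y := K.prod G) (X.prod (Biset.id G.carrier))
        (A.inflate G H a) := by
  rw [inflate, inflate, BisetFunctor.mapBiset_mapBiset, BisetFunctor.mapBiset_mapBiset]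
  exact (A.mapBiset_iso (X := H) (Y := K.prod G) (Biset.inflationNat X) a).symm

theorem restrict_mapBiset (A : GreenBisetFunctor.{u, v, w} k D) (G : BisetCat k D)
    {H K : BisetCat k D} (X : Biset K.carrier H.carrier) (a : A.obj (H.prod G)) :
    A.restrict G K
        (A.mapBiset (X := H.prod G) (Y := K.prod G) (X.prod (Biset.id G.carrier)) a) =
      A.mapBiset X (A.restrict G H a) := by
  rw [restrict, restrict, BisetFunctor.mapBiset_mapBiset, BisetFunctor.mapBiset_mapBiset]
  exact A.mapBiset_iso (X := H.prod G) (Y := K) (Biset.restrictionNat X) a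

theorem inflate_times (A : GreenBisetFunctor.{u, v, w} k D) (G K H : BisetCat k D)
    (a : A.obj K) (b : A.obj H) :
    A.inflate G (K.prod H) (A.times K H a b) =
      A.shiftTimes G K H (A.inflate G K a) (A.inflate G H b) := by
  rw [shiftTimes_apply, inflate, inflate, inflate, times_mapBiset_ofHom,
    BisetFunctor.mapBiset_ofHom_ofHom]
  -- Both sides are restriction of `a × b` along `((k, h), g) ↦ (k, h)`: the diagonal of `G`
  -- disappears under the projections.
  rfl

theorem restrict_shiftTimes (A : GreenBisetFunctor.{u, v, w} k D) (G K H : BisetCat k D)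
    (a : A.obj (K.prod G)) (b : A.obj (H.prod G)) :
    A.restrict G (K.prod H) (A.shiftTimes G K H a b) =
      A.times K H (A.restrict G K a) (A.restrict G H b) := by
  rw [shiftTimes_apply, restrict, restrict, restrict, times_mapBiset_ofHom,
    BisetFunctor.mapBiset_ofHom_ofHom]
  -- Both sides are restriction of `a × b` along `(k, h) ↦ ((k, 1), (h, 1))`, since the diagonal of
  -- `G` sends `1` to `(1, 1)`.
  rfl

/-- The identity element of `A_G` is inflated from the trivial group, and the composite `1 → 1 × G →
1` is the identity. -/
theorem restrict_shiftEps (A : GreenBisetFunctor.{u, v, w} k D) (G : BisetCat k D) :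
    A.restrict G (BisetCat.one k D) (A.shiftEps G) = A.eps :=
  (A.mapBiset_ofHom_ofHom (X := BisetCat.one k D) (Y := (BisetCat.one k D).prod G)
    (Z := BisetCat.one k D) _ _ A.eps).trans (A.mapBiset_id A.eps)

/-- Inflation along the projections `H × G → H` as a morphism from `A` to `A_G`. -/
noncomputable def inflation (A : GreenBisetFunctor.{u, v, w} k D) (G : BisetCat k D) :
    Hom A (A.shift G) where
  app H := A.inflate G H
  app_mapBiset X a := (A.inflate_mapBiset G X a).trans (A.shift_mapBiset G X _).symm
  app_times K H a b := A.inflate_times G K H a b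
  -- The projection `1 × G → 1` is the trivial homomorphism along which the identity element of
  -- `A_G` is defined.
  app_eps := rfl

/-- Restriction along the inclusions `H → H × G` as a morphism from `A_G` to `A`. -/
noncomputable def restriction (A : GreenBisetFunctor.{u, v, w} k D) (G : BisetCat k D) :
    Hom (A.shift G) A where
  app H := A.restrict G H
  app_mapBiset {_ K} X a :=
    (congrArg (A.restrict G K) (A.shift_mapBiset G X a)).trans (A.restrict_mapBiset G X a)
  app_times K H a b := A.restrict_shiftTimes G K H a b
  app_eps := A.restrict_shiftEps G

end GreenBisetFunctor

/-- Supports move against morphisms: inflation `A → A_G` bounds the support of `A_G` by that of `A`,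
and restriction `A_G → A` gives the reverse inclusion. -/
theorem mainTheorem1 (k : Type v) [CommRing k] (D : AdmissibleClass.{u})
    (A : GreenBisetFunctor.{u, v, w} k D) (G : BisetCat k D) :
    (A.shift G).essentialSupport = A.essentialSupport :=
  Set.Subset.antisymm (A.inflation G).essentialSupport_subset
    (A.restriction G).essentialSupport_subset
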